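/- Let $\mathbb K$ be a field of characteristic $0$ and let $(A,d)$, $A=\bigoplus_{p\in\mathbb Z}A^p$, be a unital differential graded commutative $\mathbb K$-algebra with $d$ of degree $1$. Write $\bar a$ for the degree of a homogeneous element $a$, let $[f,g]=fg-(-1)^{\bar f\bar g}gf$ be the graded commutator of homogeneous linear maps $A\to A$, and let $A[n]$ be the shift $A[n]^i=A^{n+i}$. A linear map $f\colon A\to A$ is called quasi-BV if for all homogeneous $a,b,c\in A$ $$f(abc)+f(a)bc+(-1)^{\bar a\bar b}f(b)ac+(-1)^{\bar c(\bar a+\bar b)}f(c)ab=f(ab)c+(-1)^{\bar a(\bar b+\bar c)}f(bc)a+(-1)^{\bar b\bar c}f(ac)b$$ (for homogeneous $f$: $f$ is a differential operator of order $\le 2$ with $f(1)=0$). Let $k\in\mathbb Z$, let $\boldsymbol i\colon A\to A$ be a quasi-BV operator of degree $-2k$, and put $\boldsymbol l=[\boldsymbol i,d]$. Assume that $[\boldsymbol l,\boldsymbol i]$ is also quasi-BV, and let $[\,,]_{\boldsymbol l}$ be the bilinear bracket of degree $-2k+1$ on $A$ given, for $a$ homogeneous and $b\in A$, by $$[a,b]_{\boldsymbol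 l}=(-1)^{\bar a}\bigl(\boldsymbol l(ab)-\boldsymbol l(a)b\bigr)-a\,\boldsymbol l(b).$$ 1. $(A,d,\cdot,[\,,]_{\boldsymbol l})$ is a (differential) Gerstenhaber algebra, i.e. $(A[2k-1],d,[\,,]_{\boldsymbol l})$ is a differential graded Lie algebra (DGLA) and the Poisson identity $[a,bc]_{\boldsymbol l}=[a,b]_{\boldsymbol l}c+(-1)^{(\bar a-2k+1)\bar b}\,b[a,c]_{\boldsymbol l}$ holds. The DGLA $(A[2k-1],d,[\,,]_{\boldsymbol l})$ is homotopy abelian: it is connected by a finite zigzag of quasi-isomorphisms of DGLAs to a DGLA with zero bracket. 2. If in addition $\boldsymbol l^2=0$, then $(A,d,\cdot,[\,,]_{\boldsymbol l},\boldsymbol l)$ is a (differential) Batalin–Vilkovisky algebra: a Gerstenhaber algebra as in 1. whose bracket is generated, by the formula above, by the quasi-BV operator $\boldsymbol l$ of odd degree $-2k+1$, with $\boldsymbol l^2=0$ and $[d,\boldsymbol l]=0$. -/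

import Mathlib

universe u v

section Operators

variable {K : Type u} [Field K] {A : Type v} [AddCommGroup A] [Module K A]

/-- The linear map `f` is homogeneous of degree `n` for the grading `𝒜`. -/
def IsHomogeneousOfDegree (𝒜 : ℤ → Submodule K A) (n : ℤ) (f : A →ₗ[K] A) : Prop :=
  ∀ ⦃p : ℤ⦄ ⦃a : A⦄, a ∈ 𝒜 p → f a ∈ 𝒜 (p + n)

/-- The graded commutator `[f, g] = f g - (-1) ^ (m n) g f` of a linear map `f` of degree `m` and a
linear map `g` of degree `n`. -/
def gradedCommutator (m n : ℤ) (f g : A →ₗ[K] A) : A →ₗ[K] A :=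
  f ∘ₗ g - (m * n).negOnePow • (g ∘ₗ f)

/-- The grading of the shift `A[m]`, namely `A[m] ^ n = A ^ (m + n)`. -/
def shiftGrading (𝒜 : ℤ → Submodule K A) (m : ℤ) : ℤ → Submodule K A :=
  fun n => 𝒜 (m + n)

end Operators

/-! ### Differential graded Lie algebras -/

/-- The graded vector space `L = ⨁ 𝓛 n`, with `d` and `br`, is a differential graded Lie algebra
(over a field of characteristic zero). -/
structure IsDGLA {K : Type u} [Field K] {L : Type v} [AddCommGroup L] [Module K L]
    (𝓛 : ℤ → Submodule K L) (d : L →ₗ[K] L) (br : L →ₗ[K] L →ₗ[K] L) : Prop where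
  isInternal : DirectSum.IsInternal 𝓛
  d_mem : IsHomogeneousOfDegree 𝓛 1 d
  d_d : ∀ x, d (d x) = 0
  br_mem : ∀ ⦃m n : ℤ⦄ ⦃x y : L⦄, x ∈ 𝓛 m → y ∈ 𝓛 n → br x y ∈ 𝓛 (m + n)
  skew : ∀ ⦃m n : ℤ⦄ ⦃x y : L⦄, x ∈ 𝓛 m → y ∈ 𝓛 n →
    br x y = -((m * n).negOnePow • br y x)
  leibniz : ∀ ⦃m : ℤ⦄ ⦃x : L⦄, x ∈ 𝓛 m → ∀ y,
    d (br x y) = br (d x) y + m.negOnePow • br x (d y)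
  jacobi : ∀ ⦃m n : ℤ⦄ ⦃x y : L⦄, x ∈ 𝓛 m → y ∈ 𝓛 n → ∀ z,
    br x (br y z) = br (br x y) z + (m * n).negOnePow • br y (br x z)

/-- A differential graded Lie algebra over `K`. -/
structure DGLA (K : Type u) [Field K] where
  carrier : Type v
  [addCommGroup : AddCommGroup carrier]
  [module : Module K carrier]
  grading : ℤ → Submodule K carrier
  d : carrier →ₗ[K] carrier
  bracket : carrier →ₗ[K] carrier →ₗ[K] carrier
  isDGLA : IsDGLA grading d bracket

namespace DGLA

universe w

attribute [instance] DGLA.addCommGroup DGLA.module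

variable {K : Type u} [Field K]

/-- A DGLA is abelian if its bracket is zero. -/
def IsAbelian (L : DGLA.{u, v} K) : Prop := ∀ x y : L.carrier, L.bracket x y = 0

/-- Morphisms of DGLAs: linear maps of degree zero commuting with differentials and brackets. -/
structure Hom (L : DGLA.{u, v} K) (M : DGLA.{u, w} K) where
  toLinearMap : L.carrier →ₗ[K] M.carrier
  map_mem : ∀ ⦃n : ℤ⦄ ⦃x : L.carrier⦄, x ∈ L.grading n → toLinearMap x ∈ M.grading n
  map_d : ∀ x, toLinearMap (L.d x) = M.d (toLinearMap x)
  map_bracket : ∀ x y, toLinearMap (L.bracket x y) = M.bracket (toLinearMap x) (toLinearMap y)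

/-- The coboundaries, as a subspace of the cocycles. -/
def coboundaries (L : DGLA.{u, v} K) : Submodule K (LinearMap.ker L.d) :=
  (LinearMap.range L.d).comap (LinearMap.ker L.d).subtype

/-- The (total) cohomology `ker d / im d`; it is the direct sum over `n` of the `H ^ n`. -/
abbrev Cohomology (L : DGLA.{u, v} K) : Type v := LinearMap.ker L.d ⧸ L.coboundaries

namespace Hom

variable {L : DGLA.{u, v} K} {M : DGLA.{u, w} K}

/-- The map induced by a morphism on cocycles. -/
def cocyclesMap (f : Hom L M) : LinearMap.ker L.d →ₗ[K] LinearMap.ker M.d :=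
  f.toLinearMap.restrict (fun x hx => by
    rw [LinearMap.mem_ker] at hx ⊢
    rw [← f.map_d, hx, map_zero])

/-- The map induced by a morphism on cohomology. -/
def cohomologyMap (f : Hom L M) : L.Cohomology →ₗ[K] M.Cohomology :=
  Submodule.mapQ L.coboundaries M.coboundaries f.cocyclesMap (by
    rintro ⟨x, hx⟩ ⟨y, hy⟩
    refine ⟨f.toLinearMap y, ?_⟩
    rw [← f.map_d, hy]
    rfl)

/-- A quasi-isomorphism is a morphism that induces an isomorphism on cohomology. -/
def IsQuasiIso (f : Hom L M) : Prop := Function.Bijective f.cohomologyMap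

end Hom

/-- There is a quasi-isomorphism of DGLAs from `L` to `M`. -/
def ExistsQuasiIso (L : DGLA.{u, v} K) (M : DGLA.{u, w} K) : Prop :=
  ∃ f : Hom L M, f.IsQuasiIso

/-- `L` is homotopy abelian: it is connected by a finite zigzag of quasi-isomorphisms of DGLAs with
an abelian DGLA. The universe `max u v` is large enough for free Lie algebras over `K` on `L`; the
first arrow `M → L` only serves to pass to this universe (`M` can always be a copy of `L`). -/
def IsHomotopyAbelian (L : DGLA.{u, v} K) : Prop :=
  ∃ M N : DGLA.{u, max u v} K,
    ExistsQuasiIso M L ∧ Relation.EqvGen ExistsQuasiIso M N ∧ N.IsAbelian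

end DGLA

/-! ### Graded commutative algebras and second order operators -/

section GradedAlgebras

variable {K : Type u} [Field K] {A : Type v} [Ring A] [Algebra K A] (𝒜 : ℤ → Submodule K A)

/-- The graded algebra `A = ⨁ 𝒜 p`, with `d`, is a differential graded commutative algebra. -/
structure IsDGCommAlgebra [GradedAlgebra 𝒜] (d : A →ₗ[K] A) : Prop where
  comm : ∀ ⦃p q : ℤ⦄ ⦃a b : A⦄, a ∈ 𝒜 p → b ∈ 𝒜 q → a * b = (p * q).negOnePow • (b * a)
  d_mem : IsHomogeneousOfDegree 𝒜 1 d
  d_d : ∀ a, d (d a) = 0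
  d_mul : ∀ ⦃p : ℤ⦄ ⦃a : A⦄, a ∈ 𝒜 p → ∀ b, d (a * b) = d a * b + p.negOnePow • (a * d b)

/-- Quasi-Batalin-Vilkovisky operators, by the seven terms identity. For a homogeneous `f` on a
graded commutative algebra, it says that `f` is a differential operator of order at most `2` with
`f 1 = 0`. -/
def IsQuasiBV (f : A →ₗ[K] A) : Prop :=
  ∀ ⦃p q r : ℤ⦄ ⦃a b c : A⦄, a ∈ 𝒜 p → b ∈ 𝒜 q → c ∈ 𝒜 r →
    f (a * b * c) + f a * b * c + (p * q).negOnePow • (f b * a * c)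
        + (r * (p + q)).negOnePow • (f c * a * b)
      = f (a * b) * c + (p * (q + r)).negOnePow • (f (b * c) * a)
        + (q * r).negOnePow • (f (a * c) * b)

/-- The linear map with `a ↦ (-1) ^ p a` for `a` of degree `p`. -/
noncomputable def signMap [GradedAlgebra 𝒜] : A →ₗ[K] A :=
  DirectSum.coeLinearMap 𝒜
    ∘ₗ DirectSum.lmap (fun p : ℤ => p.negOnePow • (LinearMap.id : 𝒜 p →ₗ[K] 𝒜 p))
    ∘ₗ (DirectSum.decomposeLinearEquiv 𝒜).toLinearMap

theorem signMap_apply_of_mem [GradedAlgebra 𝒜] {p : ℤ} {a : A} (ha : a ∈ 𝒜 p) :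
    signMap 𝒜 a = p.negOnePow • a := by
  simp only [signMap, LinearMap.comp_apply, LinearEquiv.coe_coe,
    DirectSum.decomposeLinearEquiv_apply]
  rw [DirectSum.decompose_of_mem 𝒜 ha, ← DirectSum.lof_eq_of K, DirectSum.lmap_lof,
    DirectSum.coeLinearMap_lof]
  rfl

/-- The bilinear bracket generated by `l`; see `koszulBracket_apply_of_mem` for its values
`[a, b] = (-1) ^ p (l (a b) - l a b) - a l b`, for `a` of degree `p`. -/
noncomputable def koszulBracket [GradedAlgebra 𝒜] (l : A →ₗ[K] A) : A →ₗ[K] A →ₗ[K] A :=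
  (LinearMap.mul K A).compr₂ l ∘ₗ signMap 𝒜
    - LinearMap.mul K A ∘ₗ l ∘ₗ signMap 𝒜
    - (LinearMap.mul K A).compl₂ l

theorem koszulBracket_apply_of_mem [GradedAlgebra 𝒜] (l : A →ₗ[K] A) {p : ℤ} {a : A}
    (ha : a ∈ 𝒜 p) (b : A) :
    koszulBracket 𝒜 l a b = p.negOnePow • (l (a * b) - l a * b) - a * l b := by
  simp only [koszulBracket, LinearMap.sub_apply, LinearMap.comp_apply, LinearMap.compr₂_apply,
    LinearMap.compl₂_apply, LinearMap.mul_apply', signMap_apply_of_mem 𝒜 ha]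
  rcases Int.even_or_odd p with hp | hp
  · simp [Int.negOnePow_even p hp]
  · simp only [Int.negOnePow_odd p hp, Units.neg_smul, one_smul, neg_mul, map_neg]
    abel

/-- `A`, with differential `d` and bracket `br` of odd degree `-m`, is a (differential)
Gerstenhaber algebra: `A[m]` is a DGLA and the Poisson identity holds. -/
structure IsGerstenhaberAlgebra [GradedAlgebra 𝒜] (m : ℤ) (d : A →ₗ[K] A)
    (br : A →ₗ[K] A →ₗ[K] A) : Prop where
  isDGCommAlgebra : IsDGCommAlgebra 𝒜 d
  odd : Odd m
  isDGLA : IsDGLA (shiftGrading 𝒜 m) d br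
  poisson : ∀ ⦃p q : ℤ⦄ ⦃a b : A⦄, a ∈ 𝒜 p → b ∈ 𝒜 q → ∀ c,
    br a (b * c) = br a b * c + ((p - m) * q).negOnePow • (b * br a c)

/-- The DGLA `(A[m], d, br)` underlying a Gerstenhaber algebra. -/
def IsGerstenhaberAlgebra.toDGLA {𝒜 : ℤ → Submodule K A} [GradedAlgebra 𝒜] {m : ℤ}
    {d : A →ₗ[K] A} {br : A →ₗ[K] A →ₗ[K] A} (h : IsGerstenhaberAlgebra 𝒜 m d br) :
    DGLA.{u, v} K where
  carrier := A
  grading := shiftGrading 𝒜 m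
  d := d
  bracket := br
  isDGLA := h.isDGLA

/-- A (differential) Batalin-Vilkovisky algebra: a Gerstenhaber algebra whose bracket, of odd degree
`-m`, is generated by a quasi-BV operator `Δ` of degree `-m` that squares to zero and commutes (in
the graded sense) with `d`. -/
structure IsBatalinVilkoviskyAlgebra [GradedAlgebra 𝒜] (m : ℤ) (d : A →ₗ[K] A)
    (br : A →ₗ[K] A →ₗ[K] A) (Δ : A →ₗ[K] A) : Prop where
  isGerstenhaberAlgebra : IsGerstenhaberAlgebra 𝒜 m d br
  Δ_mem : IsHomogeneousOfDegree 𝒜 (-m) Δ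
  isQuasiBV : IsQuasiBV 𝒜 Δ
  Δ_Δ : Δ ∘ₗ Δ = 0
  d_Δ : gradedCommutator 1 (-m) d Δ = 0
  generates : ∀ ⦃p : ℤ⦄ ⦃a : A⦄, a ∈ 𝒜 p → ∀ b,
    br a b = p.negOnePow • (Δ (a * b) - Δ a * b) - a * Δ b

end GradedAlgebras

-- For a quasi-BV operator `f`, the double graded commutator of `f` with the multiplications by `a`
-- and `b` is multiplication by the Leibniz defect of `f` at `(a, b)`, and this characterises
-- quasi-BV operators (`isQuasiBV_iff`). Statements about second order operators thus become Jacobi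
-- identities for graded commutators in `End A`.
--
-- Let `B` be the defect of `i`, with a Koszul sign: a graded skew operator of degree -1 on the
-- shift `A[2k-1]`. Two facts about `B` carry the theorem. First, `d` is a derivation and has no
-- defect, so the defect of `[i, d]` is that of `i` commuted with `d`; after the shift, the bracket
-- is the coboundary `δB` (`leibnizDefect_commutator`). Second, since `[l, i]` has order at most 2,
-- its triple commutator with multiplications vanishes; expanding it by Jacobi gives `[B, [,]] = 0`
-- (`leibnizDefect_six_term`). These are the content of `IsBracketHomotopy`.
--
-- The rest of the Lie theory is formal. The bracket is closed because it is exact, which is the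
-- Leibniz rule. Applying `δ` to `[B, [,]] = 0` gives twice the Jacobi identity. For homotopy
-- abelianity, take the polynomial forms `L[t, dt]` with the bracket `t [x, y] + dt B(x, y)`: its
-- Leibniz rule amounts to `δB = [,]`, and the `dt` part of its Jacobi identity to `[B, [,]] = 0`,
-- since `dt² = 0` kills the terms quadratic in `B`. Evaluation at `t = 1` lands in `L`, evaluation
-- at `t = 0` in `L` with zero bracket, and both are quasi-isomorphisms by the Poincaré lemma in
-- characteristic zero (`IsBracketHomotopy.existsQuasiIso_path`).
--
-- The Poisson identity is separate: it says that `l` is quasi-BV, which holds because `i` is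
-- (`IsQuasiBV.commutator_differential`).

universe w

open scoped TensorProduct Polynomial

/-! ### Internal gradings -/

section Internal

variable {K : Type u} [Field K] {L : Type v} [AddCommGroup L] [Module K L]

/-- Independence is witnessed by linear projections, and these survive tensoring and products;
together with `exists_projections` this transports gradings to polynomial forms. -/
theorem DirectSum.isInternal_of_projections (𝓛 : ℤ → Submodule K L) (π : ℤ → L →ₗ[K] L)
    (hself : ∀ n, ∀ x ∈ 𝓛 n, π n x = x) (hne : ∀ m n, m ≠ n → ∀ x ∈ 𝓛 n, π m x = 0)
    (htop : ⨆ n, 𝓛 n = ⊤) : DirectSum.IsInternal 𝓛 := by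
  rw [DirectSum.isInternal_submodule_iff_iSupIndep_and_iSup_eq_top]
  refine ⟨fun n => Submodule.disjoint_def.2 fun x hx hx' => ?_, htop⟩
  have hle : (⨆ j, ⨆ (_ : j ≠ n), 𝓛 j) ≤ LinearMap.ker (π n) :=
    iSup₂_le fun j hj y hy => hne n j hj.symm y hy
  rw [← hself n x hx]
  exact hle hx'

theorem DirectSum.IsInternal.exists_projections {𝓛 : ℤ → Submodule K L}
    (h : DirectSum.IsInternal 𝓛) :
    ∃ π : ℤ → L →ₗ[K] L, (∀ n, ∀ x ∈ 𝓛 n, π n x = x) ∧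
      ∀ m n, m ≠ n → ∀ x ∈ 𝓛 n, π m x = 0 := by
  let e : (DirectSum ℤ fun n => 𝓛 n) ≃ₗ[K] L :=
    LinearEquiv.ofBijective (DirectSum.coeLinearMap 𝓛) h
  have he : ∀ n (x : 𝓛 n), e.symm (x : L) = DirectSum.lof K ℤ (fun n => 𝓛 n) n x := by
    intro n x
    rw [LinearEquiv.symm_apply_eq]
    exact (DirectSum.coeLinearMap_lof 𝓛 n x).symm
  refine ⟨fun n => (𝓛 n).subtype ∘ₗ DirectSum.component K ℤ (fun n => 𝓛 n) n ∘ₗ e.symm.toLinearMap,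
    fun n x hx => ?_, fun m n hmn x hx => ?_⟩
  · have := he n ⟨x, hx⟩
    simp only [LinearMap.comp_apply, LinearEquiv.coe_coe]
    rw [this, DirectSum.component.lof_self]
    rfl
  · have := he n ⟨x, hx⟩
    simp only [LinearMap.comp_apply, LinearEquiv.coe_coe]
    rw [this, DirectSum.component.of, dif_neg hmn.symm, map_zero]

theorem DirectSum.IsInternal.linearMap_ext {M : Type*} [AddCommGroup M] [Module K M]
    {𝓛 : ℤ → Submodule K L} (h : DirectSum.IsInternal 𝓛) {f g : L →ₗ[K] M}
    (hfg : ∀ n, ∀ x ∈ 𝓛 n, f x = g x) : f = g := by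
  refine LinearMap.ext fun x => ?_
  have hle : (⨆ n, 𝓛 n) ≤ LinearMap.eqLocus f g := iSup_le fun n y hy => hfg n y hy
  rw [h.submodule_iSup_eq_top] at hle
  exact hle (Submodule.mem_top (x := x))

theorem DirectSum.IsInternal.comp_equiv {𝓛 : ℤ → Submodule K L} (h : DirectSum.IsInternal 𝓛)
    (e : ℤ ≃ ℤ) : DirectSum.IsInternal fun n => 𝓛 (e n) := by
  rw [DirectSum.isInternal_submodule_iff_iSupIndep_and_iSup_eq_top] at h ⊢
  exact ⟨h.1.comp e.injective, by rw [← h.2]; exact e.iSup_comp (g := 𝓛)⟩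

theorem DirectSum.IsInternal.comap_linearEquiv {M : Type*} [AddCommGroup M] [Module K M]
    {𝓛 : ℤ → Submodule K L} (h : DirectSum.IsInternal 𝓛) (e : M ≃ₗ[K] L) :
    DirectSum.IsInternal fun n => (𝓛 n).comap e.toLinearMap := by
  obtain ⟨π, hself, hne⟩ := h.exists_projections
  refine DirectSum.isInternal_of_projections _
    (fun n => e.symm.toLinearMap ∘ₗ π n ∘ₗ e.toLinearMap) (fun n x hx => ?_)
    (fun m n hmn x hx => ?_) ?_
  · simp [hself n (e x) hx]
  · simp [hne m n hmn (e x) hx]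
  · have := h.submodule_iSup_eq_top
    rw [← Submodule.comap_top e.toLinearMap, ← this]
    have hm : ∀ N : Submodule K L, N.comap e.toLinearMap = N.map e.symm.toLinearMap := fun N =>
      (Submodule.map_equiv_eq_comap_symm e.symm N).symm
    simp only [hm, Submodule.map_iSup]

end Internal

/-! ### Brackets that are coboundaries -/

/-- The bilinear operator `B` of degree `-1` exhibits the bracket `br` as a coboundary, and the
commutator of `B` with `br` vanishes. -/
structure IsBracketHomotopy {K : Type u} [Field K] {L : Type v} [AddCommGroup L] [Module K L]
    (𝓛 : ℤ → Submodule K L) (d : L →ₗ[K] L) (br B : L →ₗ[K] L →ₗ[K] L) : Prop where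
  mem : ∀ ⦃m n : ℤ⦄ ⦃x y : L⦄, x ∈ 𝓛 m → y ∈ 𝓛 n → B x y ∈ 𝓛 (m + n - 1)
  skew : ∀ ⦃m n : ℤ⦄ ⦃x y : L⦄, x ∈ 𝓛 m → y ∈ 𝓛 n → B x y = -((m * n).negOnePow • B y x)
  bracket_eq : ∀ ⦃m : ℤ⦄ ⦃x : L⦄, x ∈ 𝓛 m → ∀ y,
    br x y = d (B x y) + B (d x) y + m.negOnePow • B x (d y)
  jacobi : ∀ ⦃m n : ℤ⦄ ⦃x y : L⦄, x ∈ 𝓛 m → y ∈ 𝓛 n → ∀ z,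
    B x (br y z) + m.negOnePow • br x (B y z) = B (br x y) z + br (B x y) z
      + (m * n).negOnePow • (B y (br x z) + n.negOnePow • br y (B x z))

namespace IsBracketHomotopy

variable {K : Type u} [Field K] {L : Type v} [AddCommGroup L] [Module K L]
  {𝓛 : ℤ → Submodule K L} {d : L →ₗ[K] L} {br B : L →ₗ[K] L →ₗ[K] L}

theorem br_mem (h : IsBracketHomotopy 𝓛 d br B) (hd : IsHomogeneousOfDegree 𝓛 1 d)
    {m n : ℤ} {x y : L} (hx : x ∈ 𝓛 m) (hy : y ∈ 𝓛 n) : br x y ∈ 𝓛 (m + n) := by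
  rw [h.bracket_eq hx]
  refine add_mem (add_mem ?_ ?_) ?_
  · simpa using hd (h.mem hx hy)
  · have := h.mem (hd hx) hy
    rwa [show m + 1 + n - 1 = m + n by ring] at this
  · have := h.mem hx (hd hy)
    rw [show m + (n + 1) - 1 = m + n by ring] at this
    rcases Int.units_eq_one_or m.negOnePow with hm | hm <;> rw [hm] <;> simpa using this

/-- An exact bilinear operation is closed: substituting `bracket_eq` everywhere, the terms in `B`
cancel by `d² = 0`. -/
theorem leibniz (h : IsBracketHomotopy 𝓛 d br B) (hd : IsHomogeneousOfDegree 𝓛 1 d)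
    (hdd : ∀ x, d (d x) = 0) {m : ℤ} {x : L} (hx : x ∈ 𝓛 m) (y : L) :
    d (br x y) = br (d x) y + m.negOnePow • br x (d y) := by
  rw [h.bracket_eq hx, h.bracket_eq hx, h.bracket_eq (hd hx), Int.negOnePow_succ]
  rcases Int.units_eq_one_or m.negOnePow with hm | hm <;> rw [hm] <;>
    simp [hdd] <;> abel

/-- No Jacobi identity is assumed: the coboundary of `[B, br] = 0` is `[δB, br] = [br, br] = 0`,
because `br` is closed. This is twice the Jacobi identity. -/
theorem isDGLA [CharZero K] (h : IsBracketHomotopy 𝓛 d br B) (hint : DirectSum.IsInternal 𝓛)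
    (hd : IsHomogeneousOfDegree 𝓛 1 d) (hdd : ∀ x, d (d x) = 0) : IsDGLA 𝓛 d br where
  isInternal := hint
  d_mem := hd
  d_d := hdd
  br_mem _ _ _ _ hx hy := h.br_mem hd hx hy
  skew m n x y hx hy := by
    rw [h.bracket_eq hx, h.bracket_eq hy, h.skew hx hy, h.skew (hd hx) hy, h.skew hx (hd hy),
      add_mul, mul_add, one_mul, mul_one, Int.negOnePow_add, Int.negOnePow_add]
    rcases Int.units_eq_one_or m.negOnePow with hm | hm <;>
    rcases Int.units_eq_one_or n.negOnePow with hn | hn <;>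
    rcases Int.units_eq_one_or (m * n).negOnePow with hmn | hmn <;>
    rw [hm, hn, hmn] <;> simp <;> abel
  leibniz _ _ hx y := h.leibniz hd hdd hx y
  jacobi m n x y hx hy z := by
    -- The `e`'s are the terms of the coboundary of `[B, br] = 0`; the `a`'s and `c`'s rewrite `δB`
    -- as `br` in outer and inner position; the `b`'s and `l`'s are Leibniz rules.
    have e0 := congrArg d (h.jacobi hx hy z)
    have e1 := h.jacobi (hd hx) hy z
    have e2 := h.jacobi hx (hd hy) z
    have e3 := h.jacobi hx hy (d z)
    have l1 := h.leibniz hd hdd hy z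
    have l2 := h.leibniz hd hdd hx z
    have l3 := h.leibniz hd hdd hx y
    have a1 := h.bracket_eq hx (br y z)
    have a2 := h.bracket_eq (h.br_mem hd hx hy) z
    have a3 := h.bracket_eq hy (br x z)
    have b1 := h.leibniz hd hdd hx (B y z)
    have b2 := h.leibniz hd hdd (h.mem hx hy) z
    have b3 := h.leibniz hd hdd hy (B x z)
    have c1 := congrArg (br x) (h.bracket_eq hy z)
    have c2 := congrArg (fun w => br w z) (h.bracket_eq hx y)
    have c3 := congrArg (br y) (h.bracket_eq hx z)
    have two : (2 : K) ≠ 0 := two_ne_zero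
    -- The combination produces each Jacobi term twice, once from `δB` outside and once from `δB`
    -- inside.
    refine smul_right_injective L two ?_
    simp only [add_mul, mul_add, one_mul, mul_one, Int.negOnePow_add, Int.negOnePow_sub,
      Int.negOnePow_one] at *
    rw [l1] at a1
    rw [l3] at a2
    rw [l2] at a3
    generalize m.negOnePow = u at *
    generalize n.negOnePow = v at *
    generalize (m * n).negOnePow = w at *
    rcases Int.units_eq_one_or u with rfl | rfl <;>
    rcases Int.units_eq_one_or v with rfl | rfl <;>
    rcases Int.units_eq_one_or w with rfl | rfl <;>
    simp only [mul_one, mul_neg, neg_neg, one_smul, Units.neg_smul,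
      map_add, map_neg, LinearMap.add_apply, LinearMap.neg_apply, smul_add, smul_neg] at * <;>
    [linear_combination (norm := module) e0 + e1 + e2 + e3 + a1 - a2 - a3 - b1 + b2 + b3
      + c1 - c2 - c3;
    linear_combination (norm := module) e0 + e1 + e2 + e3 + a1 - a2 + a3 - b1 + b2 - b3
      + c1 - c2 + c3;
    linear_combination (norm := module) e0 + e1 + e2 - e3 + a1 - a2 - a3 - b1 + b2 - b3
      + c1 - c2 - c3;
    linear_combination (norm := module) e0 + e1 + e2 - e3 + a1 - a2 + a3 - b1 + b2 + b3
      + c1 - c2 + c3;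
    linear_combination (norm := module) e0 + e1 - e2 - e3 + a1 - a2 - a3 + b1 + b2 + b3
      + c1 - c2 - c3;
    linear_combination (norm := module) e0 + e1 - e2 - e3 + a1 - a2 + a3 + b1 + b2 - b3
      + c1 - c2 + c3;
    linear_combination (norm := module) e0 + e1 - e2 + e3 + a1 - a2 - a3 + b1 + b2 - b3
      + c1 - c2 - c3;
    linear_combination (norm := module) e0 + e1 - e2 + e3 + a1 - a2 + a3 + b1 + b2 + b3
      + c1 - c2 + c3]

end IsBracketHomotopy

/-! ### Polynomial forms on the line, with a deformed bracket -/

section PolynomialExtension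

variable {K : Type u} [Field K] {L : Type v} [AddCommGroup L] [Module K L]

/-- The polynomials with coefficients in `N`. -/
noncomputable def polynomialSubmodule (N : Submodule K L) : Submodule K (L ⊗[K] K[X]) :=
  LinearMap.range (N.subtype.rTensor K[X])

theorem units_smul_tmul (e : ℤˣ) (a : L) (f : K[X]) : (e • a) ⊗ₜ[K] f = e • a ⊗ₜ[K] f := by
  rcases Int.units_eq_one_or e with rfl | rfl <;> simp [TensorProduct.neg_tmul]

theorem tmul_mem_polynomialSubmodule {N : Submodule K L} {a : L} (ha : a ∈ N) (f : K[X]) :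
    a ⊗ₜ f ∈ polynomialSubmodule N :=
  ⟨(⟨a, ha⟩ : N) ⊗ₜ f, rfl⟩

@[elab_as_elim]
theorem polynomialSubmodule_induction {N : Submodule K L} {P : L ⊗[K] K[X] → Prop}
    {x : L ⊗[K] K[X]} (hx : x ∈ polynomialSubmodule N)
    (tmul : ∀ a ∈ N, ∀ f : K[X], P (a ⊗ₜ f)) (add : ∀ x y, P x → P y → P (x + y)) : P x := by
  obtain ⟨x, rfl⟩ := hx
  induction x using TensorProduct.induction_on with
  | zero =>
    have := tmul 0 N.zero_mem 0
    rwa [TensorProduct.zero_tmul] at this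
  | tmul a f => exact tmul a a.2 f
  | add x y hx hy => rw [map_add]; exact add _ _ hx hy

theorem isInternal_polynomialSubmodule {𝓛 : ℤ → Submodule K L} (h : DirectSum.IsInternal 𝓛) :
    DirectSum.IsInternal fun n => polynomialSubmodule (𝓛 n) := by
  obtain ⟨π, hself, hne⟩ := h.exists_projections
  refine DirectSum.isInternal_of_projections _ (fun n => (π n).rTensor K[X]) (fun n x hx => ?_)
    (fun m n hmn x hx => ?_) (eq_top_iff.2 fun x _ => ?_)
  · refine polynomialSubmodule_induction hx (fun a ha f => ?_) fun x y hx hy => ?_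
    · rw [LinearMap.rTensor_tmul, hself n a ha]
    · rw [map_add, hx, hy]
  · refine polynomialSubmodule_induction hx (fun a ha f => ?_) fun x y hx hy => ?_
    · rw [LinearMap.rTensor_tmul, hne m n hmn a ha, TensorProduct.zero_tmul]
    · rw [map_add, hx, hy, add_zero]
  · induction x using TensorProduct.induction_on with
    | zero => exact zero_mem _
    | add x y hx hy => exact add_mem (hx trivial) (hy trivial)
    | tmul a f =>
      have hle : (⨆ n, 𝓛 n) ≤ (⨆ n, polynomialSubmodule (𝓛 n)).comap
          ((TensorProduct.mk K L K[X]).flip f) :=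
        iSup_le fun n a ha => Submodule.mem_iSup_of_mem (p := fun n => polynomialSubmodule (𝓛 n)) n
          (tmul_mem_polynomialSubmodule ha f)
      rw [h.submodule_iSup_eq_top] at hle
      exact hle (Submodule.mem_top (x := a))

/-- The grading of the polynomial differential forms `x₀ + dt x₁` on the line with coefficients in
`L`, as the pairs `(x₀, x₁)`. -/
noncomputable def pathGrading (𝓛 : ℤ → Submodule K L) (n : ℤ) :
    Submodule K ((L ⊗[K] K[X]) × (L ⊗[K] K[X])) :=
  (polynomialSubmodule (𝓛 n)).prod (polynomialSubmodule (𝓛 (n - 1)))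

theorem isInternal_pathGrading {𝓛 : ℤ → Submodule K L} (h : DirectSum.IsInternal 𝓛) :
    DirectSum.IsInternal (pathGrading 𝓛) := by
  have h' := isInternal_polynomialSubmodule h
  obtain ⟨π, hself, hne⟩ := h'.exists_projections
  refine DirectSum.isInternal_of_projections _ (fun n => (π n).prodMap (π (n - 1)))
    (fun n x hx => ?_) (fun m n hmn x hx => ?_) (eq_top_iff.2 ?_)
  · exact Prod.ext (hself n _ hx.1) (hself (n - 1) _ hx.2)
  · exact Prod.ext (hne m n hmn _ hx.1) (hne (m - 1) (n - 1) (by simpa using hmn) _ hx.2)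
  · rintro ⟨x, y⟩ -
    have hx : (⨆ n, polynomialSubmodule (𝓛 n)) ≤ Submodule.comap
        (LinearMap.inl K (L ⊗[K] K[X]) (L ⊗[K] K[X])) (⨆ n, pathGrading 𝓛 n) :=
      iSup_le fun n a ha => Submodule.mem_iSup_of_mem (p := pathGrading 𝓛) n
        (show (a, (0 : L ⊗[K] K[X])) ∈ pathGrading 𝓛 n from ⟨ha, zero_mem _⟩)
    have hy : (⨆ n, polynomialSubmodule (𝓛 n)) ≤ Submodule.comap
        (LinearMap.inr K (L ⊗[K] K[X]) (L ⊗[K] K[X])) (⨆ n, pathGrading 𝓛 n) :=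
      iSup_le fun n a ha => Submodule.mem_iSup_of_mem (p := pathGrading 𝓛) (n + 1)
        (show ((0 : L ⊗[K] K[X]), a) ∈ pathGrading 𝓛 (n + 1) from
          ⟨zero_mem _, by simpa using ha⟩)
    rw [h'.submodule_iSup_eq_top] at hx hy
    have hx' : (x, (0 : L ⊗[K] K[X])) ∈ ⨆ n, pathGrading 𝓛 n := hx Submodule.mem_top
    have hy' : ((0 : L ⊗[K] K[X]), y) ∈ ⨆ n, pathGrading 𝓛 n := hy Submodule.mem_top
    have := add_mem hx' hy'
    rwa [Prod.mk_add_mk, add_zero, zero_add] at this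

/-- The multiplication of `K[X]` followed by multiplication by `X`. -/
noncomputable def mulX (K : Type u) [Field K] : K[X] →ₗ[K] K[X] →ₗ[K] K[X] :=
  (LinearMap.mul K K[X]).compr₂ (LinearMap.mulLeft K Polynomial.X)

@[simp] theorem mulX_apply (f g : K[X]) : mulX K f g = Polynomial.X * (f * g) := rfl

section Bilinear

variable {φ : L →ₗ[K] L →ₗ[K] L} {μ : K[X] →ₗ[K] K[X] →ₗ[K] K[X]}

theorem map₂_mem_polynomialSubmodule {N₁ N₂ N₃ : Submodule K L}
    (h : ∀ x ∈ N₁, ∀ y ∈ N₂, φ x y ∈ N₃) {x y : L ⊗[K] K[X]} (hx : x ∈ polynomialSubmodule N₁)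
    (hy : y ∈ polynomialSubmodule N₂) :
    TensorProduct.map₂ φ μ x y ∈ polynomialSubmodule N₃ := by
  refine polynomialSubmodule_induction hx (fun a ha f => ?_) fun x x' hx hx' => ?_
  · refine polynomialSubmodule_induction hy (fun b hb g => ?_) fun y y' hy hy' => ?_
    · exact tmul_mem_polynomialSubmodule (h a ha b hb) _
    · rw [map_add]; exact add_mem hy hy'
  · rw [map_add, LinearMap.add_apply]; exact add_mem hx hx'

theorem map₂_skew {N₁ N₂ : Submodule K L} (hμ : ∀ f g, μ f g = μ g f) (e : ℤˣ)
    (h : ∀ x ∈ N₁, ∀ y ∈ N₂, φ x y = -(e • φ y x)) {x y : L ⊗[K] K[X]}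
    (hx : x ∈ polynomialSubmodule N₁) (hy : y ∈ polynomialSubmodule N₂) :
    TensorProduct.map₂ φ μ x y = -(e • TensorProduct.map₂ φ μ y x) := by
  refine polynomialSubmodule_induction hx (fun a ha f => ?_) fun x x' hx hx' => ?_
  · refine polynomialSubmodule_induction hy (fun b hb g => ?_) fun y y' hy hy' => ?_
    · rw [TensorProduct.map₂_apply_tmul, TensorProduct.map₂_apply_tmul, TensorProduct.map_tmul,
        TensorProduct.map_tmul, h a ha b hb, hμ f g]
      rcases Int.units_eq_one_or e with rfl | rfl <;> simp [TensorProduct.neg_tmul]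
    · rw [map_add, map_add, LinearMap.add_apply, hy, hy', smul_add, neg_add]
  · rw [map_add, map_add, LinearMap.add_apply, hx, hx', smul_add, neg_add]

end Bilinear

theorem rTensor_mem_polynomialSubmodule {N₁ N₂ : Submodule K L} {f : L →ₗ[K] L}
    (h : ∀ x ∈ N₁, f x ∈ N₂) {x : L ⊗[K] K[X]} (hx : x ∈ polynomialSubmodule N₁) :
    f.rTensor K[X] x ∈ polynomialSubmodule N₂ :=
  polynomialSubmodule_induction hx (fun a ha _ => tmul_mem_polynomialSubmodule (h a ha) _)
    fun x y hx hy => by rw [map_add]; exact add_mem hx hy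

theorem lTensor_mem_polynomialSubmodule {N : Submodule K L} (f : K[X] →ₗ[K] K[X])
    {x : L ⊗[K] K[X]} (hx : x ∈ polynomialSubmodule N) :
    f.lTensor L x ∈ polynomialSubmodule N :=
  polynomialSubmodule_induction hx (fun _ ha _ => tmul_mem_polynomialSubmodule ha _)
    fun x y hx hy => by rw [map_add]; exact add_mem hx hy

theorem rTensor_sign {𝓛 : ℤ → Submodule K L} {s : L →ₗ[K] L}
    (hs : ∀ n, ∀ x ∈ 𝓛 n, s x = n.negOnePow • x) {n : ℤ} {x : L ⊗[K] K[X]}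
    (hx : x ∈ polynomialSubmodule (𝓛 n)) : s.rTensor K[X] x = n.negOnePow • x := by
  refine polynomialSubmodule_induction hx (fun a ha f => ?_) fun x x' hx hx' => ?_
  · rw [LinearMap.rTensor_tmul, hs n a ha]
    rcases Int.units_eq_one_or n.negOnePow with h | h <;> rw [h] <;> simp [TensorProduct.neg_tmul]
  · rw [map_add, hx, hx', smul_add]

variable {𝓛 : ℤ → Submodule K L} {d : L →ₗ[K] L} {br B : L →ₗ[K] L →ₗ[K] L}

theorem IsDGLA.map₂_leibniz (h : IsDGLA 𝓛 d br) (μ : K[X] →ₗ[K] K[X] →ₗ[K] K[X])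
    {m : ℤ} {x : L ⊗[K] K[X]}
    (hx : x ∈ polynomialSubmodule (𝓛 m)) (y : L ⊗[K] K[X]) :
    d.rTensor K[X] (TensorProduct.map₂ br μ x y) = TensorProduct.map₂ br μ (d.rTensor K[X] x) y
      + m.negOnePow • TensorProduct.map₂ br μ x (d.rTensor K[X] y) := by
  refine polynomialSubmodule_induction hx (fun a ha f => ?_) fun x x' hx hx' => ?_
  · induction y using TensorProduct.induction_on with
    | zero => simp
    | tmul b g =>
      simp only [TensorProduct.map₂_apply_tmul, TensorProduct.map_tmul, LinearMap.rTensor_tmul]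
      rw [h.leibniz ha b, TensorProduct.add_tmul, units_smul_tmul]
    | add y y' hy hy' => simp only [map_add, hy, hy', smul_add]; abel
  · simp only [map_add, LinearMap.add_apply, hx, hx', smul_add]; abel

theorem IsDGLA.map₂_jacobi (h : IsDGLA 𝓛 d br) {m n : ℤ} {x y : L ⊗[K] K[X]}
    (hx : x ∈ polynomialSubmodule (𝓛 m)) (hy : y ∈ polynomialSubmodule (𝓛 n))
    (z : L ⊗[K] K[X]) :
    TensorProduct.map₂ br (mulX K) x (TensorProduct.map₂ br (mulX K) y z)
      = TensorProduct.map₂ br (mulX K) (TensorProduct.map₂ br (mulX K) x y) z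
        + (m * n).negOnePow •
          TensorProduct.map₂ br (mulX K) y (TensorProduct.map₂ br (mulX K) x z) := by
  refine polynomialSubmodule_induction hx (fun a ha f => ?_) fun x x' hx hx' => ?_
  · refine polynomialSubmodule_induction hy (fun b hb g => ?_) fun y y' hy hy' => ?_
    · induction z using TensorProduct.induction_on with
      | zero => simp
      | tmul c k =>
        simp only [TensorProduct.map₂_apply_tmul, TensorProduct.map_tmul, mulX_apply]
        rw [h.jacobi ha hb c, TensorProduct.add_tmul, units_smul_tmul]
        congr 2
        · ring
        · rw [show Polynomial.X * (g * (Polynomial.X * (f * k)))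
            = Polynomial.X * (f * (Polynomial.X * (g * k))) by ring]
      | add z z' hz hz' => simp only [map_add, hz, hz', smul_add]; abel
    · simp only [map_add, LinearMap.add_apply, hy, hy', smul_add]; abel
  · simp only [map_add, LinearMap.add_apply, hx, hx', smul_add]; abel

/-- Every term contains `B` once and the bracket once, so on pure tensors all polynomial factors
equal `t f g k`, and the identity is that of `L`. -/
theorem IsBracketHomotopy.map₂_jacobi (h : IsBracketHomotopy 𝓛 d br B) {m n : ℤ}
    {x y : L ⊗[K] K[X]} (hx : x ∈ polynomialSubmodule (𝓛 m))
    (hy : y ∈ polynomialSubmodule (𝓛 n)) (z : L ⊗[K] K[X]) :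
    TensorProduct.map₂ B (LinearMap.mul K K[X]) x (TensorProduct.map₂ br (mulX K) y z)
      + m.negOnePow •
        TensorProduct.map₂ br (mulX K) x (TensorProduct.map₂ B (LinearMap.mul K K[X]) y z)
      = TensorProduct.map₂ B (LinearMap.mul K K[X]) (TensorProduct.map₂ br (mulX K) x y) z
        + TensorProduct.map₂ br (mulX K) (TensorProduct.map₂ B (LinearMap.mul K K[X]) x y) z
        + (m * n).negOnePow •
          (TensorProduct.map₂ B (LinearMap.mul K K[X]) y (TensorProduct.map₂ br (mulX K) x z)
            + n.negOnePow • TensorProduct.map₂ br (mulX K) y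
              (TensorProduct.map₂ B (LinearMap.mul K K[X]) x z)) := by
  refine polynomialSubmodule_induction hx (fun a ha f => ?_) fun x x' hx hx' => ?_
  · refine polynomialSubmodule_induction hy (fun b hb g => ?_) fun y y' hy hy' => ?_
    · induction z using TensorProduct.induction_on with
      | zero => simp
      | tmul c k =>
        have := congrArg (fun w => w ⊗ₜ[K] (Polynomial.X * (f * g * k))) (h.jacobi ha hb c)
        simp only [TensorProduct.add_tmul, units_smul_tmul, smul_add] at this
        simp only [TensorProduct.map₂_apply_tmul, TensorProduct.map_tmul, mulX_apply, LinearMap.mul_apply', smul_add]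
        rw [show Polynomial.X * (f * (g * k)) = Polynomial.X * (f * g * k) by ring,
          show f * (Polynomial.X * (g * k)) = Polynomial.X * (f * g * k) by ring,
          show Polynomial.X * (f * g) * k = Polynomial.X * (f * g * k) by ring,
          show g * (Polynomial.X * (f * k)) = Polynomial.X * (f * g * k) by ring,
          show Polynomial.X * (g * (f * k)) = Polynomial.X * (f * g * k) by ring]
        exact this
      | add z z' hz hz' =>
        simp only [map_add, smul_add, Units.smul_def] at hz hz' ⊢
        linear_combination (norm := module) hz + hz'
    · simp only [map_add, LinearMap.add_apply, smul_add, Units.smul_def] at hy hy' ⊢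
      linear_combination (norm := module) hy + hy'
  · simp only [map_add, LinearMap.add_apply, smul_add, Units.smul_def] at hx hx' ⊢
    linear_combination (norm := module) hx + hx'

/-- Differentiating the factor `t` leaves the undeformed bracket, which is `δB`. This is the `dt`
part of the Leibniz rule for forms without `dt`. -/
theorem IsBracketHomotopy.derivative_map₂ (h : IsBracketHomotopy 𝓛 d br B) {m : ℤ}
    {x : L ⊗[K] K[X]} (hx : x ∈ polynomialSubmodule (𝓛 m)) (y : L ⊗[K] K[X]) :
    Polynomial.derivative.lTensor L (TensorProduct.map₂ br (mulX K) x y)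
      = d.rTensor K[X] (TensorProduct.map₂ B (LinearMap.mul K K[X]) x y)
        + TensorProduct.map₂ B (LinearMap.mul K K[X]) (d.rTensor K[X] x) y
        + m.negOnePow • TensorProduct.map₂ B (LinearMap.mul K K[X]) x (d.rTensor K[X] y)
        + TensorProduct.map₂ br (mulX K) (Polynomial.derivative.lTensor L x) y
        + TensorProduct.map₂ br (mulX K) x (Polynomial.derivative.lTensor L y) := by
  refine polynomialSubmodule_induction hx (fun a ha f => ?_) fun x x' hx hx' => ?_
  · induction y using TensorProduct.induction_on with
    | zero => simp
    | tmul b g =>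
      have e := congrArg (fun w => w ⊗ₜ[K] (f * g)) (h.bracket_eq ha b)
      simp only [TensorProduct.add_tmul, units_smul_tmul] at e
      simp only [TensorProduct.map₂_apply_tmul, TensorProduct.map_tmul, LinearMap.rTensor_tmul, LinearMap.lTensor_tmul,
        mulX_apply, LinearMap.mul_apply', Polynomial.derivative_mul, Polynomial.derivative_X,
        one_mul, mul_add, TensorProduct.tmul_add]
      rw [e]
      abel
    | add y y' hy hy' =>
      simp only [map_add, smul_add, Units.smul_def] at hy hy' ⊢
      linear_combination (norm := module) hy + hy'
  · simp only [map_add, LinearMap.add_apply, smul_add, Units.smul_def] at hx hx' ⊢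
    linear_combination (norm := module) hx + hx'

/-- The differential `x₀ + dt x₁ ↦ d x₀ + dt (x₀' - d x₁)`. -/
noncomputable def pathDifferential (d : L →ₗ[K] L) :
    (L ⊗[K] K[X]) × (L ⊗[K] K[X]) →ₗ[K] (L ⊗[K] K[X]) × (L ⊗[K] K[X]) :=
  (d.rTensor K[X] ∘ₗ LinearMap.fst K _ _).prod
    (Polynomial.derivative.lTensor L ∘ₗ LinearMap.fst K _ _ - d.rTensor K[X] ∘ₗ LinearMap.snd K _ _)

@[simp] theorem pathDifferential_apply (x : (L ⊗[K] K[X]) × (L ⊗[K] K[X])) :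
    pathDifferential d x = (d.rTensor K[X] x.1,
      Polynomial.derivative.lTensor L x.1 - d.rTensor K[X] x.2) := rfl

/-- The bracket `t [x, y] + dt B(x, y)`, extended bilinearly (in the graded sense, with the help of
the sign operator `s`) to polynomial differential forms. -/
noncomputable def pathBracket (s : L →ₗ[K] L) (br B : L →ₗ[K] L →ₗ[K] L) :
    (L ⊗[K] K[X]) × (L ⊗[K] K[X]) →ₗ[K] (L ⊗[K] K[X]) × (L ⊗[K] K[X]) →ₗ[K]
      (L ⊗[K] K[X]) × (L ⊗[K] K[X]) :=
  LinearMap.mk₂ K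
    (fun x y => (TensorProduct.map₂ br (mulX K) x.1 y.1,
      TensorProduct.map₂ B (LinearMap.mul K K[X]) x.1 y.1
        + TensorProduct.map₂ br (mulX K) x.2 y.1
        + TensorProduct.map₂ br (mulX K) (s.rTensor K[X] x.1) y.2))
    (fun x x' y => by
      refine Prod.ext ?_ ?_ <;> simp only [Prod.fst_add, Prod.snd_add, map_add,
        LinearMap.add_apply]
      abel)
    (fun c x y => by
      refine Prod.ext ?_ ?_ <;> simp only [Prod.smul_fst, Prod.smul_snd, map_smul,
        LinearMap.smul_apply, smul_add])
    (fun x y y' => by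
      refine Prod.ext ?_ ?_ <;> simp only [Prod.fst_add, Prod.snd_add, map_add]
      abel)
    (fun c x y => by
      refine Prod.ext ?_ ?_ <;> simp only [Prod.smul_fst, Prod.smul_snd, map_smul,
        smul_add])

@[simp] theorem pathBracket_apply (s : L →ₗ[K] L) (x y : (L ⊗[K] K[X]) × (L ⊗[K] K[X])) :
    pathBracket s br B x y = (TensorProduct.map₂ br (mulX K) x.1 y.1,
      TensorProduct.map₂ B (LinearMap.mul K K[X]) x.1 y.1
        + TensorProduct.map₂ br (mulX K) x.2 y.1
        + TensorProduct.map₂ br (mulX K) (s.rTensor K[X] x.1) y.2) := rfl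

theorem rTensor_d_d (hdd : ∀ x, d (d x) = 0) (x : L ⊗[K] K[X]) :
    d.rTensor K[X] (d.rTensor K[X] x) = 0 := by
  rw [← LinearMap.comp_apply, ← LinearMap.rTensor_comp, show d ∘ₗ d = 0 from LinearMap.ext hdd,
    LinearMap.rTensor_zero, LinearMap.zero_apply]

theorem rTensor_lTensor_comm (d : L →ₗ[K] L) (f : K[X] →ₗ[K] K[X]) (x : L ⊗[K] K[X]) :
    d.rTensor K[X] (f.lTensor L x) = f.lTensor L (d.rTensor K[X] x) := by
  rw [← LinearMap.comp_apply, ← LinearMap.comp_apply, LinearMap.rTensor_comp_lTensor,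
    LinearMap.lTensor_comp_rTensor]

/-- The components without `dt` only use that `t [x, y]` extends the bracket of `L`. In the `dt`
components, the new inputs are `derivative_map₂` for Leibniz and `IsBracketHomotopy.map₂_jacobi` for
Jacobi. -/
theorem IsBracketHomotopy.isDGLA_path (h : IsBracketHomotopy 𝓛 d br B) (hL : IsDGLA 𝓛 d br)
    {s : L →ₗ[K] L} (hs : ∀ n, ∀ x ∈ 𝓛 n, s x = n.negOnePow • x) :
    IsDGLA (pathGrading 𝓛) (pathDifferential d) (pathBracket s br B) where
  isInternal := isInternal_pathGrading hL.isInternal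
  d_mem n x hx := by
    refine ⟨rTensor_mem_polynomialSubmodule (fun a ha => hL.d_mem ha) hx.1, sub_mem ?_ ?_⟩
    · rw [add_sub_cancel_right]
      exact lTensor_mem_polynomialSubmodule _ hx.1
    · rw [show n + 1 - 1 = n - 1 + 1 by ring]
      exact rTensor_mem_polynomialSubmodule (fun a ha => hL.d_mem ha) hx.2
  d_d x := by
    simp [rTensor_d_d hL.d_d, rTensor_lTensor_comm]
  br_mem m n x y hx hy := by
    refine ⟨map₂_mem_polynomialSubmodule (fun a ha b hb => hL.br_mem ha hb) hx.1 hy.1,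
      add_mem (add_mem ?_ ?_) ?_⟩
    · exact map₂_mem_polynomialSubmodule (fun a ha b hb => h.mem ha hb) hx.1 hy.1
    · rw [show m + n - 1 = m - 1 + n by ring]
      exact map₂_mem_polynomialSubmodule (fun a ha b hb => hL.br_mem ha hb) hx.2 hy.1
    · rw [show m + n - 1 = m + (n - 1) by ring]
      refine map₂_mem_polynomialSubmodule (fun a ha b hb => hL.br_mem ha hb) ?_ hy.2
      rw [rTensor_sign hs hx.1]
      rcases Int.units_eq_one_or m.negOnePow with e | e <;> rw [e] <;> simpa using hx.1
  skew m n x y hx hy := by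
    have hμ : ∀ f g : K[X], mulX K f g = mulX K g f := fun f g => by simp [mul_comm f g]
    have e1 := map₂_skew hμ _ (fun a ha b hb => hL.skew ha hb) hx.1 hy.1
    have e2 := map₂_skew (μ := LinearMap.mul K K[X]) (fun f g => by simp [mul_comm f g]) _
      (fun a ha b hb => h.skew ha hb) hx.1 hy.1
    have e3 := map₂_skew hμ _ (fun a ha b hb => hL.skew ha hb) hx.2 hy.1
    have e4 := map₂_skew hμ _ (fun a ha b hb => hL.skew ha hb) hx.1 hy.2
    rw [pathBracket_apply, pathBracket_apply, rTensor_sign hs hx.1, rTensor_sign hs hy.1]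
    simp only [sub_mul, mul_sub, one_mul, mul_one, Int.negOnePow_sub] at e3 e4
    refine Prod.ext e1 ?_
    simp only [Prod.snd_neg, Prod.smul_snd]
    rw [e2, e3]
    generalize m.negOnePow = u at *
    generalize n.negOnePow = v at *
    generalize (m * n).negOnePow = w at *
    rcases Int.units_eq_one_or u with rfl | rfl <;>
    rcases Int.units_eq_one_or v with rfl | rfl <;>
    rcases Int.units_eq_one_or w with rfl | rfl <;>
    simp at e4 ⊢ <;> rw [e4] <;> abel
  leibniz m x hx y := by
    have e1 := hL.map₂_leibniz (mulX K) hx.1 y.1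
    have e2 := h.derivative_map₂ hx.1 y.1
    have e3 := hL.map₂_leibniz (mulX K) hx.1 y.2
    have e4 := hL.map₂_leibniz (mulX K) hx.2 y.1
    have hdx := rTensor_sign hs (rTensor_mem_polynomialSubmodule (fun a ha => hL.d_mem ha) hx.1)
    simp only [pathBracket_apply, pathDifferential_apply, rTensor_sign hs hx.1, hdx]
    refine Prod.ext e1 ?_
    simp only [Prod.snd_add, Prod.smul_snd, Int.negOnePow_succ, Int.negOnePow_sub,
      Int.negOnePow_one] at *
    rw [e2]
    generalize m.negOnePow = u at *
    rcases Int.units_eq_one_or u with rfl | rfl <;>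
    simp at e3 e4 ⊢ <;> rw [e3, e4] <;> abel
  jacobi m n x y hx hy z := by
    have e1 := hL.map₂_jacobi hx.1 hy.1 z.1
    have e2 := h.map₂_jacobi hx.1 hy.1 z.1
    have e3 := hL.map₂_jacobi hx.2 hy.1 z.1
    have e4 := hL.map₂_jacobi hx.1 hy.2 z.1
    have e5 := hL.map₂_jacobi hx.1 hy.1 z.2
    have hxy := rTensor_sign hs (map₂_mem_polynomialSubmodule (μ := mulX K)
      (fun a ha b hb => hL.br_mem ha hb) hx.1 hy.1)
    simp only [pathBracket_apply, rTensor_sign hs hx.1, rTensor_sign hs hy.1, hxy]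
    refine Prod.ext e1 ?_
    simp only [Prod.snd_add, Prod.smul_snd, sub_mul, mul_sub, one_mul, mul_one,
      Int.negOnePow_add, Int.negOnePow_sub] at *
    generalize TensorProduct.map₂ br (mulX K) = P at *
    generalize TensorProduct.map₂ B (LinearMap.mul K K[X]) = Q at *
    generalize m.negOnePow = u at *
    generalize n.negOnePow = v at *
    generalize (m * n).negOnePow = w at *
    rcases Int.units_eq_one_or w with rfl | rfl <;>
    rcases Int.units_eq_one_or u with rfl | rfl <;>
    rcases Int.units_eq_one_or v with rfl | rfl <;>
    simp only [mul_one, mul_neg, neg_neg, one_smul, Units.neg_smul,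
      map_add, map_neg, LinearMap.add_apply, LinearMap.neg_apply, smul_add, smul_neg]
      at e2 e3 e4 e5 ⊢ <;>
    [linear_combination (norm := module) e2 + e3 + e4 + e5;
    linear_combination (norm := module) e2 + e3 + e4 - e5;
    linear_combination (norm := module) e2 + e3 - e4 - e5;
    linear_combination (norm := module) e2 + e3 - e4 + e5;
    linear_combination (norm := module) e2 + e3 + e4 + e5;
    linear_combination (norm := module) e2 + e3 + e4 - e5;
    linear_combination (norm := module) e2 + e3 - e4 - e5;
    linear_combination (norm := module) e2 + e3 - e4 + e5]

end PolynomialExtension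

/-! ### Evaluations as quasi-isomorphisms, and homotopy abelianity -/

theorem DGLA.Hom.isQuasiIso_of_cocycles {K : Type u} [Field K] {L : DGLA.{u, v} K}
    {M : DGLA.{u, w} K} (f : DGLA.Hom L M)
    (hinj : ∀ x, L.d x = 0 → f.toLinearMap x ∈ LinearMap.range M.d → x ∈ LinearMap.range L.d)
    (hsurj : ∀ y, M.d y = 0 → ∃ x, L.d x = 0 ∧ f.toLinearMap x = y) : f.IsQuasiIso := by
  constructor
  · refine (injective_iff_map_eq_zero _).2 fun x => ?_
    obtain ⟨x, rfl⟩ := Submodule.Quotient.mk_surjective _ x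
    intro hx
    exact (Submodule.Quotient.mk_eq_zero _).2
      (hinj x x.2 ((Submodule.Quotient.mk_eq_zero M.coboundaries).1 hx))
  · intro y
    obtain ⟨y, rfl⟩ := Submodule.Quotient.mk_surjective _ y
    obtain ⟨x, hx, hxy⟩ := hsurj y y.2
    refine ⟨Submodule.Quotient.mk (⟨x, hx⟩ : LinearMap.ker L.d), ?_⟩
    exact congrArg Submodule.Quotient.mk (Subtype.ext hxy)

section Primitive

variable (K : Type u) [Field K]

/-- The primitive of a polynomial that vanishes at `0`. -/
noncomputable def Polynomial.primitive : K[X] →ₗ[K] K[X] :=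
  Polynomial.lsum fun n => ((n : K) + 1)⁻¹ • Polynomial.monomial (n + 1)

variable {K}

theorem Polynomial.derivative_primitive [CharZero K] (f : K[X]) :
    Polynomial.derivative (Polynomial.primitive K f) = f := by
  induction f using Polynomial.induction_on' with
  | add p q hp hq => rw [map_add, map_add, hp, hq]
  | monomial n a =>
    have hn : (n : K) + 1 ≠ 0 := by exact_mod_cast n.succ_ne_zero
    simp [Polynomial.primitive, Polynomial.smul_monomial]
    congr 1
    field_simp

theorem Polynomial.primitive_derivative [CharZero K] (f : K[X]) :
    Polynomial.primitive K (Polynomial.derivative f) = f - Polynomial.C (f.eval 0) := by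
  induction f using Polynomial.induction_on' with
  | add p q hp hq => rw [map_add, map_add, hp, hq, Polynomial.eval_add, map_add]; abel
  | monomial n a =>
    rcases n with _ | n
    · simp
    · have hn : (n : K) + 1 ≠ 0 := by exact_mod_cast n.succ_ne_zero
      simp [Polynomial.primitive, Polynomial.smul_monomial]
      congr 1
      field_simp

end Primitive

section Path

variable {K : Type u} [Field K] {L : Type v} [AddCommGroup L] [Module K L]
  {𝓛 : ℤ → Submodule K L} {d : L →ₗ[K] L} {br B : L →ₗ[K] L →ₗ[K] L}

/-- Evaluation of polynomials with coefficients in `L`. -/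
noncomputable def evalTensor (L : Type v) [AddCommGroup L] [Module K L] (c : K) :
    L ⊗[K] K[X] →ₗ[K] L :=
  (TensorProduct.rid K L).toLinearMap ∘ₗ (Polynomial.leval c).lTensor L

@[simp] theorem evalTensor_tmul (c : K) (a : L) (f : K[X]) :
    evalTensor L c (a ⊗ₜ f) = f.eval c • a := by
  simp [evalTensor]

theorem evalTensor_rTensor (c : K) (x : L ⊗[K] K[X]) :
    evalTensor L c (d.rTensor K[X] x) = d (evalTensor L c x) := by
  induction x using TensorProduct.induction_on with
  | zero => simp
  | tmul a f => simp
  | add x y hx hy => simp only [map_add, hx, hy]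

theorem evalTensor_map₂ (c : K) (x y : L ⊗[K] K[X]) :
    evalTensor L c (TensorProduct.map₂ br (mulX K) x y)
      = c • br (evalTensor L c x) (evalTensor L c y) := by
  induction x using TensorProduct.induction_on with
  | zero => simp
  | tmul a f =>
    induction y using TensorProduct.induction_on with
    | zero => simp
    | tmul b g => simp [smul_smul, mul_comm (f.eval c)]
    | add x y hx hy => simp only [map_add, hx, hy, smul_add]
  | add x y hx hy => simp only [map_add, LinearMap.add_apply, hx, hy, smul_add]

theorem evalTensor_mem {N : Submodule K L} (c : K) {x : L ⊗[K] K[X]}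
    (hx : x ∈ polynomialSubmodule N) : evalTensor L c x ∈ N := by
  refine polynomialSubmodule_induction hx (fun a ha f => ?_) fun x y hx hy => ?_
  · rw [evalTensor_tmul]; exact N.smul_mem _ ha
  · rw [map_add]; exact add_mem hx hy

theorem exists_linearMap_primitive [CharZero K] (c : K) :
    ∃ I : L ⊗[K] K[X] →ₗ[K] L ⊗[K] K[X],
      (∀ x, Polynomial.derivative.lTensor L (I x) = x) ∧
      (∀ x, I (Polynomial.derivative.lTensor L x) = x - evalTensor L c x ⊗ₜ 1) ∧
      ∀ (d : L →ₗ[K] L) (x), d.rTensor K[X] (I x) = I (d.rTensor K[X] x) := by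
  -- The primitive normalised to vanish at `c`, that is, integration from `c` to `t`.
  let J : K[X] →ₗ[K] K[X] := Polynomial.primitive K
    - Polynomial.CAlgHom.toLinearMap ∘ₗ Polynomial.leval c ∘ₗ Polynomial.primitive K
  have hJ : ∀ f, J f = Polynomial.primitive K f
      - Polynomial.C ((Polynomial.primitive K f).eval c) := fun f => rfl
  refine ⟨J.lTensor L, fun x => ?_, fun x => ?_, fun d x => rTensor_lTensor_comm d J x⟩
  · induction x using TensorProduct.induction_on with
    | zero => simp
    | tmul a f => simp [hJ, Polynomial.derivative_primitive]
    | add x y hx hy => simp only [map_add, hx, hy]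
  · induction x using TensorProduct.induction_on with
    | zero => simp
    | tmul a f =>
      rw [LinearMap.lTensor_tmul, LinearMap.lTensor_tmul, hJ, Polynomial.primitive_derivative,
        evalTensor_tmul, TensorProduct.smul_tmul, ← TensorProduct.tmul_sub,
        ← Polynomial.C_mul', mul_one]
      simp
    | add x y hx hy =>
      simp only [map_add, hx, hy, TensorProduct.add_tmul]; abel

/-- Poincaré lemma: a closed form whose value at `t = c` is exact is itself exact. -/
theorem path_coboundary [CharZero K] (c : K)
    {x : (L ⊗[K] K[X]) × (L ⊗[K] K[X])} (hx : pathDifferential d x = 0)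
    (hc : evalTensor L c x.1 ∈ LinearMap.range d) : x ∈ LinearMap.range (pathDifferential d) := by
  obtain ⟨I, hI, hI', hId⟩ := exists_linearMap_primitive (L := L) c
  obtain ⟨y, hy⟩ := hc
  have h2 : Polynomial.derivative.lTensor L x.1 = d.rTensor K[X] x.2 :=
    sub_eq_zero.1 (congrArg Prod.snd hx)
  -- Integrating the `dt` part from `c` recovers `x` except for its value at `c`, because `x.1' = d
  -- x.2`; the constant `y` supplies this value.
  refine ⟨(I x.2 + y ⊗ₜ 1, 0), Prod.ext ?_ ?_⟩
  · simp [hId, ← h2, hI', hy]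
  · simp [hI]

/-- The DGLA of polynomial differential forms on the line with coefficients in `L`. -/
noncomputable def IsBracketHomotopy.path (h : IsBracketHomotopy 𝓛 d br B) (hL : IsDGLA 𝓛 d br)
    {s : L →ₗ[K] L} (hs : ∀ n, ∀ x ∈ 𝓛 n, s x = n.negOnePow • x) : DGLA.{u, max u v} K where
  carrier := (L ⊗[K] K[X]) × (L ⊗[K] K[X])
  grading := pathGrading 𝓛
  d := pathDifferential d
  bracket := pathBracket s br B
  isDGLA := h.isDGLA_path hL hs

/-- Evaluation at `t = c` turns `t [x, y]` into `c [x, y]`, so the target is `L` with its bracket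
scaled by `c`. A general `c` and an equivalence `e` cover both ends of the path and the change of
universe. -/
theorem IsBracketHomotopy.existsQuasiIso_path [CharZero K] (h : IsBracketHomotopy 𝓛 d br B)
    (hL : IsDGLA 𝓛 d br) {s : L →ₗ[K] L} (hs : ∀ n, ∀ x ∈ 𝓛 n, s x = n.negOnePow • x)
    (M : DGLA.{u, w} K) (e : L ≃ₗ[K] M.carrier) (c : K)
    (he : ∀ n, ∀ x ∈ 𝓛 n, e x ∈ M.grading n) (hd : ∀ x, e (d x) = M.d (e x))
    (hbr : ∀ x y, e (c • br x y) = M.bracket (e x) (e y)) :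
    DGLA.ExistsQuasiIso (h.path hL hs) M := by
  let f : DGLA.Hom (h.path hL hs) M :=
    { toLinearMap := e.toLinearMap ∘ₗ evalTensor L c ∘ₗ LinearMap.fst K _ _
      map_mem := fun n x hx => he n _ (evalTensor_mem c hx.1)
      map_d := fun x => (congrArg e (evalTensor_rTensor c x.1)).trans (hd _)
      map_bracket := fun x y => (congrArg e (evalTensor_map₂ c x.1 y.1)).trans (hbr _ _) }
  refine ⟨f, f.isQuasiIso_of_cocycles ?_ ?_⟩
  · rintro x hx ⟨y, hy⟩
    refine path_coboundary c hx ⟨e.symm y, e.injective ?_⟩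
    rw [hd, e.apply_symm_apply]
    exact hy
  · intro y hy
    -- Cocycles lift to constant paths.
    refine ⟨(e.symm y ⊗ₜ 1, 0), Prod.ext ?_ ?_, ?_⟩
    · have : d (e.symm y) = 0 := e.injective (by rw [hd, e.apply_symm_apply, hy, map_zero])
      change d.rTensor K[X] (e.symm y ⊗ₜ 1) = 0
      rw [LinearMap.rTensor_tmul, this, TensorProduct.zero_tmul]
    · change Polynomial.derivative.lTensor L (e.symm y ⊗ₜ 1) - d.rTensor K[X] 0 = 0
      simp
    · change e (evalTensor L c (e.symm y ⊗ₜ 1)) = y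
      simp

theorem IsDGLA.zero_bracket (hL : IsDGLA 𝓛 d br) (e : ULift.{u} L ≃ₗ[K] L) :
    IsDGLA (fun n => (𝓛 n).comap e.toLinearMap) (e.symm.toLinearMap ∘ₗ d ∘ₗ e.toLinearMap) 0 where
  isInternal := hL.isInternal.comap_linearEquiv e
  d_mem n x hx := by simpa using hL.d_mem hx
  d_d x := by simp [hL.d_d]
  br_mem _ _ _ _ _ _ := zero_mem _
  skew _ _ _ _ _ _ := by simp
  leibniz _ _ _ _ := by simp
  jacobi _ _ _ _ _ _ _ := by simp

/-- A DGLA whose bracket is the coboundary of a bilinear operator commuting with the bracket is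
homotopy abelian. -/
theorem IsBracketHomotopy.isHomotopyAbelian [CharZero K] (h : IsBracketHomotopy 𝓛 d br B)
    (hL : IsDGLA 𝓛 d br) {s : L →ₗ[K] L} (hs : ∀ n, ∀ x ∈ 𝓛 n, s x = n.negOnePow • x) :
    DGLA.IsHomotopyAbelian
      ({ carrier := L, grading := 𝓛, d := d, bracket := br, isDGLA := hL } : DGLA.{u, v} K) := by
  let e : ULift.{u} L ≃ₗ[K] L := ULift.moduleEquiv
  let N : DGLA.{u, max u v} K :=
    { carrier := ULift.{u} L
      grading := fun n => (𝓛 n).comap e.toLinearMap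
      d := e.symm.toLinearMap ∘ₗ d ∘ₗ e.toLinearMap
      bracket := 0
      isDGLA := hL.zero_bracket e }
  refine ⟨h.path hL hs, N, ?_, Relation.EqvGen.rel _ _ ?_, fun x y => rfl⟩
  · exact h.existsQuasiIso_path hL hs _ (LinearEquiv.refl K L) 1 (fun n x hx => hx)
      (fun x => rfl) (fun x y => one_smul K _)
  · refine h.existsQuasiIso_path hL hs N e.symm 0 (fun n x hx => ?_) (fun x => ?_) (fun x y => ?_)
    · change e (e.symm x) ∈ 𝓛 n
      rwa [e.apply_symm_apply]
    · change e.symm (d x) = e.symm (d (e (e.symm x)))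
      rw [e.apply_symm_apply]
    · rw [zero_smul, map_zero]
      rfl

end Path

/-! ### Signs and Jacobi identities for graded commutators -/

theorem Int.negOnePow_eq_ite (n : ℤ) : n.negOnePow = if Even n then 1 else -1 := by
  split_ifs with h
  · exact n.negOnePow_even h
  · exact n.negOnePow_odd (Int.not_even_iff_odd.1 h)

section RingIdentities

variable {R : Type*} [Ring R]

/-- The graded commutator `x y - e y x` in a ring, with a prescribed sign `e`. -/
def signCommutator (e : ℤˣ) (x y : R) : R := x * y - e • (y * x)

/-- Graded commutation with `a`, `b`, `c` acts by derivations on `[l, i]`. The letters `a`, `b` are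
distributed over `l` and `i`; `c` is distributed only when each of `l`, `i` has received one of
them, and otherwise stays outside. This makes 2 + 4 terms, in which `l` and `i` each enter through a
double commutator. -/
theorem signCommutator_jacobi_six (p q r : ℤ) (i l a b c : R) :
    signCommutator ((p + q + 1) * r).negOnePow (signCommutator ((p + 1) * q).negOnePow
        (signCommutator p.negOnePow (l * i - i * l) a) b) c
      = signCommutator ((p + q + 1) * r).negOnePow (signCommutator (p + q).negOnePow l
          (signCommutator (p * q).negOnePow (signCommutator 1 i a) b)) c
        - signCommutator ((p + q + 1) * r).negOnePow (signCommutator 1 i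
          (signCommutator ((p + 1) * q).negOnePow (signCommutator p.negOnePow l a) b)) c
        + signCommutator ((p + 1) * (q + r)).negOnePow (signCommutator p.negOnePow l a)
          (signCommutator (q * r).negOnePow (signCommutator 1 i b) c)
        - p.negOnePow • signCommutator (p * (q + r + 1)).negOnePow (signCommutator 1 i a)
          (signCommutator ((q + 1) * r).negOnePow (signCommutator q.negOnePow l b) c)
        + (p * q).negOnePow • (signCommutator ((q + 1) * (p + r)).negOnePow
            (signCommutator q.negOnePow l b)
            (signCommutator (p * r).negOnePow (signCommutator 1 i a) c)
          - q.negOnePow • signCommutator (q * (p + r + 1)).negOnePow (signCommutator 1 i b)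
            (signCommutator ((p + 1) * r).negOnePow (signCommutator p.negOnePow l a) c)) := by
  by_cases hp : Even p <;> by_cases hq : Even q <;> by_cases hr : Even r <;>
    simp only [Int.negOnePow_eq_ite, Int.even_add, Int.even_mul, hp, hq, hr, Int.not_even_one,
      signCommutator, if_true, if_false, iff_true, iff_false, not_true_eq_false, or_true, or_false,
      one_smul, Units.neg_smul] <;>
    noncomm_ring

/-- The same expansion for `[[[i, d], a], b]`; here `d` will be a derivation, so only its single
commutators appear. -/
theorem signCommutator_leibniz (p q : ℤ) (i d a b : R) :
    signCommutator ((p + 1) * q).negOnePow (signCommutator p.negOnePow (i * d - d * i) a) b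
      = -signCommutator (p + q).negOnePow d (signCommutator (p * q).negOnePow
          (signCommutator 1 i a) b)
        + signCommutator ((p + 1) * q).negOnePow (signCommutator 1 i
          (signCommutator p.negOnePow d a)) b
        + p.negOnePow • signCommutator (p * (q + 1)).negOnePow (signCommutator 1 i a)
          (signCommutator q.negOnePow d b) := by
  by_cases hp : Even p <;> by_cases hq : Even q <;>
    simp only [Int.negOnePow_eq_ite, Int.even_add, Int.even_mul, hp, hq, Int.not_even_one,
      signCommutator, if_true, if_false, iff_true, iff_false, not_true_eq_false, or_true, or_false,
      one_smul, Units.neg_smul] <;>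
    noncomm_ring

end RingIdentities

/-! ### Quasi-BV operators through double commutators -/

section QuasiBV

variable {K : Type u} [Field K] {A : Type v} [Ring A] [Algebra K A] {𝒜 : ℤ → Submodule K A}

/-- The failure of `f` to be a derivation, with sign `e`. -/
def leibnizDefect (e : ℤˣ) (f : A →ₗ[K] A) (a b : A) : A :=
  f (a * b) - f a * b - e • (a * f b)

theorem units_smul_mem {V : Type*} [AddCommGroup V] [Module K V] {N : Submodule K V} (e : ℤˣ)
    {x : V} (hx : x ∈ N) : e • x ∈ N := by
  rcases Int.units_eq_one_or e with rfl | rfl <;> simpa using hx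

variable [GradedAlgebra 𝒜]

theorem isQuasiBV_iff
    (hcomm : ∀ ⦃p q : ℤ⦄ ⦃a b : A⦄, a ∈ 𝒜 p → b ∈ 𝒜 q → a * b = (p * q).negOnePow • (b * a))
    {n : ℤ} {f : A →ₗ[K] A} (hf : IsHomogeneousOfDegree 𝒜 n f) :
    IsQuasiBV 𝒜 f ↔ ∀ ⦃p q : ℤ⦄ ⦃a b : A⦄, a ∈ 𝒜 p → b ∈ 𝒜 q →
      signCommutator ((n + p) * q).negOnePow
          (signCommutator (n * p).negOnePow (f : Module.End K A) (LinearMap.mulLeft K a))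
          (LinearMap.mulLeft K b)
        = LinearMap.mulLeft K (leibnizDefect (n * p).negOnePow f a b) := by
  -- The difference of the two sides of the seven-term identity is the operator identity evaluated
  -- at `c`, once graded commutativity has put the factors in the same order.
  have key : ∀ ⦃p q r : ℤ⦄ ⦃a b c : A⦄, a ∈ 𝒜 p → b ∈ 𝒜 q → c ∈ 𝒜 r →
      (f (a * b * c) + f a * b * c + (p * q).negOnePow • (f b * a * c)
        + (r * (p + q)).negOnePow • (f c * a * b)
        - (f (a * b) * c + (p * (q + r)).negOnePow • (f (b * c) * a)
        + (q * r).negOnePow • (f (a * c) * b)))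
      = f (a * (b * c)) - (n * p).negOnePow • (a * f (b * c))
        - ((n + p) * q).negOnePow • (b * (f (a * c) - (n * p).negOnePow • (a * f c)))
        - leibnizDefect (n * p).negOnePow f a b * c := by
    intro p q r a b c ha hb hc
    have h1 := hcomm (hf (SetLike.mul_mem_graded hb hc)) ha
    have h2 := hcomm (hf (SetLike.mul_mem_graded ha hc)) hb
    have h3 := hcomm (hf hc) (SetLike.mul_mem_graded ha hb)
    have h4 := hcomm (hf hb) ha
    have h5 := hcomm hb ha
    rw [mul_assoc (f c), h1, h2, h3, h4]
    simp only [leibnizDefect, mul_sub, sub_mul, mul_smul_comm, ← mul_assoc, h5]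
    by_cases hp : Even p <;> by_cases hq : Even q <;> by_cases hr : Even r <;>
    by_cases hn : Even n <;>
    simp [Int.negOnePow_eq_ite, Int.even_add, Int.even_mul, hp, hq, hr, hn] <;> abel
  constructor
  · intro h p q a b ha hb
    refine (DirectSum.Decomposition.isInternal 𝒜).linearMap_ext fun r c hc => ?_
    have := key ha hb hc
    rw [sub_eq_zero.2 (h ha hb hc)] at this
    exact sub_eq_zero.1 this.symm
  · intro h p q r a b c ha hb hc
    have := congrArg (fun g : Module.End K A => g c) (h ha hb)
    rw [← sub_eq_zero, key ha hb hc]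
    exact sub_eq_zero.2 this

end QuasiBV

/-! ### The Koszul bracket and its homotopy -/

section Koszul

variable {K : Type u} [Field K] {A : Type v} [Ring A] [Algebra K A] {𝒜 : ℤ → Submodule K A}
  [GradedAlgebra 𝒜]

variable (𝒜) in
/-- The bilinear operator with values `-(-1) ^ p (i (a b) - i a b - a i b)`, for `a` of degree
`p`. -/
noncomputable def koszulHomotopy (i : A →ₗ[K] A) : A →ₗ[K] A →ₗ[K] A :=
  ((LinearMap.mul K A).compl₂ i + LinearMap.mul K A ∘ₗ i - (LinearMap.mul K A).compr₂ i)
    ∘ₗ signMap 𝒜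

theorem koszulHomotopy_apply_of_mem (i : A →ₗ[K] A) {p : ℤ} {a : A} (ha : a ∈ 𝒜 p) (b : A) :
    koszulHomotopy 𝒜 i a b = -(p.negOnePow • leibnizDefect 1 i a b) := by
  simp only [koszulHomotopy, LinearMap.comp_apply, signMap_apply_of_mem 𝒜 ha]
  rcases Int.units_eq_one_or p.negOnePow with h | h <;> rw [h] <;>
    simp [leibnizDefect] <;> abel

theorem koszulBracket_eq_leibnizDefect (l : A →ₗ[K] A) {p : ℤ} {a : A} (ha : a ∈ 𝒜 p) (b : A) :
    koszulBracket 𝒜 l a b = p.negOnePow • leibnizDefect p.negOnePow l a b := by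
  rw [koszulBracket_apply_of_mem 𝒜 l ha]
  rcases Int.units_eq_one_or p.negOnePow with h | h <;> rw [h] <;>
    simp [leibnizDefect] <;> abel

theorem leibnizDefect_mem {n : ℤ} {f : A →ₗ[K] A} (hf : IsHomogeneousOfDegree 𝒜 n f) (e : ℤˣ)
    {p q : ℤ} {a b : A} (ha : a ∈ 𝒜 p) (hb : b ∈ 𝒜 q) :
    leibnizDefect e f a b ∈ 𝒜 (p + q + n) := by
  refine sub_mem (sub_mem (hf (SetLike.mul_mem_graded ha hb)) ?_) (units_smul_mem e ?_)
  · have := SetLike.mul_mem_graded (hf ha) hb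
    rwa [show p + n + q = p + q + n by ring] at this
  · have := SetLike.mul_mem_graded ha (hf hb)
    rwa [← add_assoc] at this

theorem IsHomogeneousOfDegree.comp {𝒜 : ℤ → Submodule K A} {m n : ℤ} {f g : A →ₗ[K] A}
    (hf : IsHomogeneousOfDegree 𝒜 m f) (hg : IsHomogeneousOfDegree 𝒜 n g) :
    IsHomogeneousOfDegree 𝒜 (m + n) (f ∘ₗ g) := fun p a ha => by
  have := hf (hg ha)
  rwa [show p + n + m = p + (m + n) by ring] at this

theorem IsHomogeneousOfDegree.commutator {𝒜 : ℤ → Submodule K A} {m n : ℤ} {f g : A →ₗ[K] A}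
    (hf : IsHomogeneousOfDegree 𝒜 m f) (hg : IsHomogeneousOfDegree 𝒜 n g) :
    IsHomogeneousOfDegree 𝒜 (m + n) (f ∘ₗ g - g ∘ₗ f) := fun p a ha => by
  have := hg.comp hf ha
  rw [add_comm n m] at this
  exact sub_mem (hf.comp hg ha) this

variable {d : A →ₗ[K] A} {k : ℤ} {i l : A →ₗ[K] A}

theorem IsDGCommAlgebra.signCommutator_mulLeft (hA : IsDGCommAlgebra 𝒜 d) {p : ℤ} {a : A}
    (ha : a ∈ 𝒜 p) {e : ℤˣ} (he : p.negOnePow = e) :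
    signCommutator e (d : Module.End K A) (LinearMap.mulLeft K a) = LinearMap.mulLeft K (d a) := by
  subst he
  refine LinearMap.ext fun b => ?_
  change d (a * b) - p.negOnePow • (a * d b) = d a * b
  rw [hA.d_mul ha, add_sub_cancel_right]

theorem gradedCommutator_neg_two_mul (m : ℤ) (f g : A →ₗ[K] A) :
    gradedCommutator (-2 * k) m f g = f ∘ₗ g - g ∘ₗ f := by
  rw [gradedCommutator, Int.negOnePow_even _ ⟨-k * m, by ring⟩, one_smul]

theorem gradedCommutator_neg_two_mul_right (m : ℤ) (f g : A →ₗ[K] A) :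
    gradedCommutator m (-2 * k) f g = f ∘ₗ g - g ∘ₗ f := by
  rw [gradedCommutator, Int.negOnePow_even _ ⟨-k * m, by ring⟩, one_smul]

theorem IsQuasiBV.signCommutator_even (hA : IsDGCommAlgebra 𝒜 d)
    (hi_deg : IsHomogeneousOfDegree 𝒜 (-2 * k) i) (hi : IsQuasiBV 𝒜 i) {p q : ℤ} {a b : A}
    (ha : a ∈ 𝒜 p) (hb : b ∈ 𝒜 q) {e : ℤˣ} (he : (p * q).negOnePow = e) :
    signCommutator e (signCommutator 1 (i : Module.End K A) (LinearMap.mulLeft K a))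
      (LinearMap.mulLeft K b) = LinearMap.mulLeft K (leibnizDefect 1 i a b) := by
  have := (isQuasiBV_iff hA.comm hi_deg).1 hi ha hb
  rwa [Int.negOnePow_even (-2 * k * p) ⟨-k * p, by ring⟩,
    Int.negOnePow_eq_iff ((-2 * k + p) * q) (p * q) |>.2 ⟨-k * q, by ring⟩, he] at this

theorem isQuasiBV_odd_iff (hA : IsDGCommAlgebra 𝒜 d)
    (hl_deg : IsHomogeneousOfDegree 𝒜 (-2 * k + 1) l) :
    IsQuasiBV 𝒜 l ↔ ∀ ⦃p q : ℤ⦄ ⦃a b : A⦄, a ∈ 𝒜 p → b ∈ 𝒜 q →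
      signCommutator ((p + 1) * q).negOnePow
          (signCommutator p.negOnePow (l : Module.End K A) (LinearMap.mulLeft K a))
          (LinearMap.mulLeft K b)
        = LinearMap.mulLeft K (leibnizDefect p.negOnePow l a b) := by
  rw [isQuasiBV_iff hA.comm hl_deg]
  have h1 : ∀ p : ℤ, ((-2 * k + 1) * p).negOnePow = p.negOnePow := fun p =>
    (Int.negOnePow_eq_iff _ _).2 ⟨-k * p, by ring⟩
  have h2 : ∀ p q : ℤ, ((-2 * k + 1 + p) * q).negOnePow = ((p + 1) * q).negOnePow := fun p q =>
    (Int.negOnePow_eq_iff _ _).2 ⟨-k * q, by ring⟩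
  simp only [h1, h2]

theorem IsQuasiBV.signCommutator_odd (hA : IsDGCommAlgebra 𝒜 d)
    (hl_deg : IsHomogeneousOfDegree 𝒜 (-2 * k + 1) l) (hl : IsQuasiBV 𝒜 l) {p q : ℤ} {a b : A}
    (ha : a ∈ 𝒜 p) (hb : b ∈ 𝒜 q) {e e' : ℤˣ} (he : p.negOnePow = e)
    (he' : ((p + 1) * q).negOnePow = e') :
    signCommutator e' (signCommutator e (l : Module.End K A) (LinearMap.mulLeft K a))
      (LinearMap.mulLeft K b) = LinearMap.mulLeft K (leibnizDefect e l a b) := by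
  subst he he'
  exact (isQuasiBV_odd_iff hA hl_deg).1 hl ha hb

/-- The derivation `d` has zero defect, so only the commutator of `d` with the defect of `i`
remains. After the shift, this says that the bracket is the coboundary of `koszulHomotopy`. -/
theorem leibnizDefect_commutator (hA : IsDGCommAlgebra 𝒜 d)
    (hi_deg : IsHomogeneousOfDegree 𝒜 (-2 * k) i) {p : ℤ} {a : A} (ha : a ∈ 𝒜 p) (b : A) :
    leibnizDefect p.negOnePow (i ∘ₗ d - d ∘ₗ i) a b
      = -d (leibnizDefect 1 i a b) + leibnizDefect 1 i (d a) b
        + p.negOnePow • leibnizDefect 1 i a (d b) := by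
  have h1 := hA.d_mul ha b
  have h2 := hA.d_mul (hi_deg ha) b
  have h3 := hA.d_mul ha (i b)
  rw [Int.negOnePow_eq_iff (p + -2 * k) p |>.2 ⟨-k, by ring⟩] at h2
  simp only [leibnizDefect, LinearMap.sub_apply, LinearMap.comp_apply, map_sub, one_smul, h1, h2,
    h3, map_add]
  rcases Int.units_eq_one_or p.negOnePow with h | h <;> rw [h] <;>
    simp only [one_smul, Units.neg_smul, map_neg] <;> noncomm_ring

/-- In the Jacobi expansion of `[[[i, d], a], b]`, every commutator of `d` with a multiplication is
multiplication by the differential and every double commutator of `i` is a multiplication, so the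
result is again a multiplication. -/
theorem IsQuasiBV.commutator_differential (hA : IsDGCommAlgebra 𝒜 d)
    (hi_deg : IsHomogeneousOfDegree 𝒜 (-2 * k) i) (hi : IsQuasiBV 𝒜 i) :
    IsQuasiBV 𝒜 (i ∘ₗ d - d ∘ₗ i) := by
  refine (isQuasiBV_odd_iff hA (hi_deg.commutator hA.d_mem)).2 fun p q a b ha hb => ?_
  refine (signCommutator_leibniz p q (i : Module.End K A) d _ _).trans ?_
  rw [hi.signCommutator_even hA hi_deg ha hb rfl, hA.signCommutator_mulLeft ha rfl,
    hA.signCommutator_mulLeft hb rfl, hi.signCommutator_even hA hi_deg (hA.d_mem ha) hb rfl,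
    hi.signCommutator_even hA hi_deg ha (hA.d_mem hb) rfl,
    hA.signCommutator_mulLeft (leibnizDefect_mem hi_deg 1 ha hb)
      ((Int.negOnePow_eq_iff _ _).2 ⟨-k, by ring⟩),
    leibnizDefect_commutator hA hi_deg ha]
  refine LinearMap.ext fun c => ?_
  rcases Int.units_eq_one_or p.negOnePow with h | h <;> rw [h] <;> simp <;> noncomm_ring

/-- The double commutator of `[l, i]` with multiplications is a multiplication, so the triple one
vanishes; each of the six terms of its expansion is multiplication by a composite of two defects.
This is `[B, [,]] = 0` before the shift. -/
theorem leibnizDefect_six_term (hA : IsDGCommAlgebra 𝒜 d)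
    (hi_deg : IsHomogeneousOfDegree 𝒜 (-2 * k) i) (hi : IsQuasiBV 𝒜 i)
    (hl_deg : IsHomogeneousOfDegree 𝒜 (-2 * k + 1) l) (hl : IsQuasiBV 𝒜 l)
    (hli : IsQuasiBV 𝒜 (l ∘ₗ i - i ∘ₗ l)) {p q r : ℤ} {a b c : A}
    (ha : a ∈ 𝒜 p) (hb : b ∈ 𝒜 q) (hc : c ∈ 𝒜 r) :
    leibnizDefect (p + q).negOnePow l (leibnizDefect 1 i a b) c
      - leibnizDefect 1 i (leibnizDefect p.negOnePow l a b) c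
      + leibnizDefect p.negOnePow l a (leibnizDefect 1 i b c)
      - p.negOnePow • leibnizDefect 1 i a (leibnizDefect q.negOnePow l b c)
      + (p * q).negOnePow • (leibnizDefect q.negOnePow l b (leibnizDefect 1 i a c)
        - q.negOnePow • leibnizDefect 1 i b (leibnizDefect p.negOnePow l a c)) = 0 := by
  -- The degree `-4k + 1` is written in the form `-2k' + 1` with `k' = 2k`, so that the criterion
  -- for odd operators applies to `[l, i]`.
  have hj_deg : IsHomogeneousOfDegree 𝒜 (-2 * (2 * k) + 1) (l ∘ₗ i - i ∘ₗ l) := by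
    have := hl_deg.commutator hi_deg
    rwa [show -2 * k + 1 + -2 * k = -2 * (2 * k) + 1 by ring] at this
  have key := signCommutator_jacobi_six p q r (i : Module.End K A) l (LinearMap.mulLeft K a)
    (LinearMap.mulLeft K b) (LinearMap.mulLeft K c)
  have hC {p q : ℤ} {a b : A} (ha : a ∈ 𝒜 p) (hb : b ∈ 𝒜 q) := leibnizDefect_mem hi_deg 1 ha hb
  have hP {p q : ℤ} {a b : A} (ha : a ∈ 𝒜 p) (hb : b ∈ 𝒜 q) :=
    leibnizDefect_mem hl_deg p.negOnePow ha hb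
  have hI {p q : ℤ} {a b : A} (ha : a ∈ 𝒜 p) (hb : b ∈ 𝒜 q) {e : ℤˣ} :=
    hi.signCommutator_even hA hi_deg ha hb (e := e)
  have hL {p q : ℤ} {a b : A} (ha : a ∈ 𝒜 p) (hb : b ∈ 𝒜 q) {e e' : ℤˣ} :=
    hl.signCommutator_odd hA hl_deg ha hb (e := e) (e' := e')
  have hj : signCommutator ((p + 1) * q).negOnePow (signCommutator p.negOnePow
      ((l : Module.End K A) * i - i * l) (LinearMap.mulLeft K a)) (LinearMap.mulLeft K b) = _ :=
    hli.signCommutator_odd hA hj_deg ha hb rfl rfl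
  have hjc : signCommutator ((p + q + 1) * r).negOnePow
      (LinearMap.mulLeft K (leibnizDefect p.negOnePow (l ∘ₗ i - i ∘ₗ l) a b))
      (LinearMap.mulLeft K c) = 0 := by
    refine LinearMap.ext fun x => ?_
    have := hA.comm (leibnizDefect_mem hj_deg p.negOnePow ha hb) hc
    rw [Int.negOnePow_eq_iff ((p + q + (-2 * (2 * k) + 1)) * r) ((p + q + 1) * r) |>.2
      ⟨-(2 * k) * r, by ring⟩] at this
    change _ * (c * x) - ((p + q + 1) * r).negOnePow • (c * (_ * x)) = 0
    rw [← mul_assoc, this, smul_mul_assoc, mul_assoc, sub_self]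
  rw [hj, hjc, hI ha hb rfl, hL ha hb rfl rfl, hI hb hc rfl, hL hb hc rfl rfl, hI ha hc rfl,
    hL ha hc rfl rfl,
    hL (hC ha hb) hc ((Int.negOnePow_eq_iff _ _).2 ⟨-k, by ring⟩)
      ((Int.negOnePow_eq_iff _ _).2 ⟨-k * r, by ring⟩),
    hI (hP ha hb) hc ((Int.negOnePow_eq_iff _ _).2 ⟨-k * r, by ring⟩),
    hL ha (hC hb hc) rfl ((Int.negOnePow_eq_iff _ _).2 ⟨-k * (p + 1), by ring⟩),
    hI ha (hP hb hc) ((Int.negOnePow_eq_iff _ _).2 ⟨-k * p, by ring⟩),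
    hL hb (hC ha hc) rfl ((Int.negOnePow_eq_iff _ _).2 ⟨-k * (q + 1), by ring⟩),
    hI hb (hP ha hc) ((Int.negOnePow_eq_iff _ _).2 ⟨-k * q, by ring⟩)] at key
  -- All six operators are now left multiplications; their values at `1` are the multipliers.
  have := congrArg (fun g : Module.End K A => g 1) key
  simp only [Units.smul_def] at this ⊢
  simpa only [LinearMap.add_apply, LinearMap.sub_apply, LinearMap.smul_apply, LinearMap.zero_apply,
    LinearMap.mulLeft_apply, mul_one] using this.symm

theorem negOnePow_shift (k m : ℤ) : (2 * k - 1 + m).negOnePow = -m.negOnePow := by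
  rw [← Int.negOnePow_succ]
  exact (Int.negOnePow_eq_iff _ _).2 ⟨k - 1, by ring⟩

theorem negOnePow_shift_mul_shift (k m n : ℤ) :
    ((2 * k - 1 + m) * (2 * k - 1 + n)).negOnePow
      = -((m * n).negOnePow * m.negOnePow * n.negOnePow) := by
  rw [← Int.negOnePow_add, ← Int.negOnePow_add, ← Int.negOnePow_succ]
  exact (Int.negOnePow_eq_iff _ _).2 ⟨2 * k * k - 2 * k + k * m + k * n - m - n, by ring⟩

theorem isBracketHomotopy_koszulHomotopy (hA : IsDGCommAlgebra 𝒜 d)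
    (hi_deg : IsHomogeneousOfDegree 𝒜 (-2 * k) i) (hi : IsQuasiBV 𝒜 i)
    (hl : l = i ∘ₗ d - d ∘ₗ i) (hli : IsQuasiBV 𝒜 (l ∘ₗ i - i ∘ₗ l)) :
    IsBracketHomotopy (shiftGrading 𝒜 (2 * k - 1)) d (koszulBracket 𝒜 l)
      (koszulHomotopy 𝒜 i) where
  mem m n x y hx hy := by
    change x ∈ 𝒜 _ at hx
    change y ∈ 𝒜 _ at hy
    rw [koszulHomotopy_apply_of_mem i hx]
    have := neg_mem (units_smul_mem (2 * k - 1 + m).negOnePow (leibnizDefect_mem hi_deg 1 hx hy))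
    rwa [show 2 * k - 1 + m + (2 * k - 1 + n) + -2 * k = 2 * k - 1 + (m + n - 1) by ring] at this
  skew m n x y hx hy := by
    change x ∈ 𝒜 _ at hx
    change y ∈ 𝒜 _ at hy
    have h1 := hA.comm hx hy
    have h2 := hA.comm (hi_deg hx) hy
    have h3 := hA.comm hx (hi_deg hy)
    rw [koszulHomotopy_apply_of_mem i hx, koszulHomotopy_apply_of_mem i hy, leibnizDefect,
      leibnizDefect, h1, h2, h3]
    rw [Int.negOnePow_eq_iff ((2 * k - 1 + m + -2 * k) * (2 * k - 1 + n))
        ((2 * k - 1 + m) * (2 * k - 1 + n)) |>.2 ⟨-k * (2 * k - 1 + n), by ring⟩,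
      Int.negOnePow_eq_iff ((2 * k - 1 + m) * (2 * k - 1 + n + -2 * k))
        ((2 * k - 1 + m) * (2 * k - 1 + n)) |>.2 ⟨-k * (2 * k - 1 + m), by ring⟩,
      negOnePow_shift, negOnePow_shift, negOnePow_shift_mul_shift]
    generalize m.negOnePow = u at *
    generalize n.negOnePow = v at *
    generalize (m * n).negOnePow = w at *
    rcases Int.units_eq_one_or w with rfl | rfl <;>
    rcases Int.units_eq_one_or u with rfl | rfl <;>
    rcases Int.units_eq_one_or v with rfl | rfl <;>
    simp <;> abel
  bracket_eq m x hx y := by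
    change x ∈ 𝒜 _ at hx
    rw [koszulBracket_eq_leibnizDefect l hx, koszulHomotopy_apply_of_mem i hx,
      koszulHomotopy_apply_of_mem i hx, koszulHomotopy_apply_of_mem i (hA.d_mem hx), hl,
      leibnizDefect_commutator hA hi_deg hx, Int.negOnePow_succ,
      negOnePow_shift]
    rcases Int.units_eq_one_or m.negOnePow with h | h <;> rw [h] <;> simp
  jacobi m n x y hx hy z := by
    change x ∈ 𝒜 _ at hx
    change y ∈ 𝒜 _ at hy
    have hl_deg : IsHomogeneousOfDegree 𝒜 (-2 * k + 1) l := hl ▸ hi_deg.commutator hA.d_mem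
    have hl_bv : IsQuasiBV 𝒜 l := hl ▸ hi.commutator_differential hA hi_deg
    -- The six-term identity needs a homogeneous third argument; linearity in `z` gives the general
    -- case.
    induction z using DirectSum.Decomposition.inductionOn 𝒜 with
    | zero => simp
    | add z z' hz hz' =>
      simp only [map_add, smul_add, Units.smul_def] at hz hz' ⊢
      linear_combination (norm := module) hz + hz'
    | @homogeneous r z =>
      have key := leibnizDefect_six_term hA hi_deg hi hl_deg hl_bv hli hx hy z.2
      have g1 := koszulHomotopy_apply_of_mem i hx
      have g2 := koszulHomotopy_apply_of_mem i hy
      have g3 := koszulBracket_eq_leibnizDefect l hx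
      have g4 := koszulBracket_eq_leibnizDefect l hy
      have g5 := koszulHomotopy_apply_of_mem i
        (leibnizDefect_mem hl_deg (2 * k - 1 + m).negOnePow hx hy)
      have g6 := koszulBracket_eq_leibnizDefect l (leibnizDefect_mem hi_deg 1 hx hy)
      rw [g1 z, g2 z, g3 z, g4 z, g1 y, g3 y]
      have s4 : (2 * k - 1 + m + (2 * k - 1 + n)).negOnePow = m.negOnePow * n.negOnePow := by
        rw [← Int.negOnePow_add]
        exact (Int.negOnePow_eq_iff _ _).2 ⟨2 * k - 1, by ring⟩
      have s5 : (2 * k - 1 + m + (2 * k - 1 + n) + -2 * k).negOnePow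
          = m.negOnePow * n.negOnePow := by
        rw [← Int.negOnePow_add]
        exact (Int.negOnePow_eq_iff _ _).2 ⟨k - 1, by ring⟩
      have s6 : (2 * k - 1 + m + (2 * k - 1 + n) + (-2 * k + 1)).negOnePow
          = -(m.negOnePow * n.negOnePow) := by
        rw [← Int.negOnePow_add, ← Int.negOnePow_succ]
        exact (Int.negOnePow_eq_iff _ _).2 ⟨k - 1, by ring⟩
      simp only [negOnePow_shift, negOnePow_shift_mul_shift, s4, s5, s6] at *
      generalize m.negOnePow = u at *
      generalize n.negOnePow = v at *
      generalize (m * n).negOnePow = w at *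
      rcases Int.units_eq_one_or w with rfl | rfl <;>
      rcases Int.units_eq_one_or u with rfl | rfl <;>
      rcases Int.units_eq_one_or v with rfl | rfl <;>
      simp only [mul_one, mul_neg, neg_neg, one_smul, Units.neg_smul, map_neg,
        LinearMap.neg_apply, smul_neg] at key g1 g2 g3 g4 g5 g6 ⊢ <;>
      simp only [g1, g2, g3, g4, g5, g6] <;>
      -- The Koszul signs of the shift amount to an overall sign depending on the parities of `m`
      -- and `n`.
      first
      | linear_combination (norm := module) key
      | linear_combination (norm := module) -key

/-- The double commutator criterion for `l`, applied to `c`, is the Poisson identity after the terms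
in `l a` are reordered by graded commutativity. -/
theorem koszulBracket_poisson (hA : IsDGCommAlgebra 𝒜 d)
    (hl_deg : IsHomogeneousOfDegree 𝒜 (-2 * k + 1) l) (hl : IsQuasiBV 𝒜 l) {p q : ℤ} {a b : A}
    (ha : a ∈ 𝒜 p) (hb : b ∈ 𝒜 q) (c : A) :
    koszulBracket 𝒜 l a (b * c) = koszulBracket 𝒜 l a b * c
      + ((p - (2 * k - 1)) * q).negOnePow • (b * koszulBracket 𝒜 l a c) := by
  have h1 : l (a * (b * c)) - p.negOnePow • (a * l (b * c))
      - ((p + 1) * q).negOnePow • (b * (l (a * c) - p.negOnePow • (a * l c)))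
      = leibnizDefect p.negOnePow l a b * c :=
    congrArg (fun g : Module.End K A => g c) (hl.signCommutator_odd hA hl_deg ha hb rfl rfl)
  have h2 := hA.comm (hl_deg ha) hb
  rw [Int.negOnePow_eq_iff ((p + (-2 * k + 1)) * q) ((p + 1) * q) |>.2 ⟨-k * q, by ring⟩] at h2
  rw [koszulBracket_eq_leibnizDefect l ha, koszulBracket_eq_leibnizDefect l ha,
    koszulBracket_eq_leibnizDefect l ha, smul_mul_assoc, ← h1,
    Int.negOnePow_eq_iff ((p - (2 * k - 1)) * q) ((p + 1) * q) |>.2 ⟨-k * q, by ring⟩]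
  simp only [leibnizDefect, ← mul_assoc (l a), h2]
  generalize p.negOnePow = u
  generalize ((p + 1) * q).negOnePow = v
  rcases Int.units_eq_one_or u with rfl | rfl <;>
  rcases Int.units_eq_one_or v with rfl | rfl <;>
  simp <;> noncomm_ring

end Koszul

/-! ### The main theorem -/

theorem theorem4p3 {K : Type u} [Field K] [CharZero K] {A : Type v} [Ring A] [Algebra K A]
    (𝒜 : ℤ → Submodule K A) [GradedAlgebra 𝒜] (d : A →ₗ[K] A) (hA : IsDGCommAlgebra 𝒜 d)
    (k : ℤ) (i : A →ₗ[K] A) (hi_deg : IsHomogeneousOfDegree 𝒜 (-2 * k) i)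
    (hi : IsQuasiBV 𝒜 i)
    (l : A →ₗ[K] A) (hl : l = gradedCommutator (-2 * k) 1 i d)
    (hli : IsQuasiBV 𝒜 (gradedCommutator (-2 * k + 1) (-2 * k) l i)) :
    (∃ hG : IsGerstenhaberAlgebra 𝒜 (2 * k - 1) d (koszulBracket 𝒜 l),
        hG.toDGLA.IsHomotopyAbelian) ∧
      (l ∘ₗ l = 0 →
        IsBatalinVilkoviskyAlgebra 𝒜 (2 * k - 1) d (koszulBracket 𝒜 l) l) := by
  rw [gradedCommutator_neg_two_mul] at hl
  rw [gradedCommutator_neg_two_mul_right] at hli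
  have hl_deg : IsHomogeneousOfDegree 𝒜 (-2 * k + 1) l := hl ▸ hi_deg.commutator hA.d_mem
  have hl_bv : IsQuasiBV 𝒜 l := hl ▸ hi.commutator_differential hA hi_deg
  have hB := isBracketHomotopy_koszulHomotopy hA hi_deg hi hl hli
  have hd : IsHomogeneousOfDegree (shiftGrading 𝒜 (2 * k - 1)) 1 d := fun p a ha => by
    have := hA.d_mem ha
    rwa [add_assoc] at this
  have hL : IsDGLA (shiftGrading 𝒜 (2 * k - 1)) d (koszulBracket 𝒜 l) :=
    hB.isDGLA ((DirectSum.Decomposition.isInternal 𝒜).comp_equiv (Equiv.addLeft (2 * k - 1)))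
      hd hA.d_d
  have hG : IsGerstenhaberAlgebra 𝒜 (2 * k - 1) d (koszulBracket 𝒜 l) :=
    { isDGCommAlgebra := hA
      odd := ⟨k - 1, by ring⟩
      isDGLA := hL
      poisson := fun p q a b ha hb c => koszulBracket_poisson hA hl_deg hl_bv ha hb c }
  -- The shift by the odd number `2k - 1` reverses parity, so the sign operator of the DGLA is minus
  -- that of the algebra.
  have hs : ∀ n, ∀ x ∈ shiftGrading 𝒜 (2 * k - 1) n, (-signMap 𝒜) x = n.negOnePow • x := by
    intro n x hx
    rw [LinearMap.neg_apply, signMap_apply_of_mem 𝒜 hx, negOnePow_shift, Units.neg_smul, neg_neg]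
  refine ⟨⟨hG, hB.isHomotopyAbelian hL hs⟩, fun hll => ?_⟩
  exact
    { isGerstenhaberAlgebra := hG
      Δ_mem := by rwa [show -(2 * k - 1) = -2 * k + 1 by ring]
      isQuasiBV := hl_bv
      Δ_Δ := hll
      d_Δ := by
        rw [gradedCommutator, Int.negOnePow_odd _ ⟨-k, by ring⟩, hl]
        refine LinearMap.ext fun x => ?_
        simp [hA.d_d]
      generates := fun p a ha b => koszulBracket_apply_of_mem 𝒜 l ha b }
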